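/- Consider the random Dirichlet series $$f(z)=a_1+\frac{a_2}{2^z}+\frac{a_3}{3^z}+\cdots,$$ where $a_1,a_2,\dots$ are independent, identically distributed complex normal random variables whose real and imaginary parts are independent real normal variables with mean $0$ and the same variance $\sigma^2>0$ (for example, complex standard normal variables, in either usual normalization $\sigma^2=1$ or $\sigma^2=\tfrac12$). With probability one, the series converges (as the limit of its partial sums) at every $z\in\mathbb{C}$ with $\operatorname{Re}(z)>1/2$. For every Borel set $B\subseteq\{\operatorname{Re}(z)>1/2\}$, the number of (distinct) zeros of $f$ in $B$ is a random variable with values in $\{0,1,2,\dots,\infty\}$. For all real $1/2<x_1<x_2$ and $y_1<y_2$, the expected number of zeros of $f$ in the rectangle $x_1<\operatorname{Re}(z)<x_2$, $y_1<\operatorname{Im}(z)<y_2$ is finite and equal to $$\frac{1}{2\pi}\left(\frac{\zeta'(2x_2)}{\zeta(2x_2)}-\frac{\zeta'(2x_1)}{\zeta(2x_1)}\right)(y_2-y_1),$$ where $\zeta$ is the Riemann zeta function. In particular, the density of zeros becomes infinite as we approach the critical line $\operatorname{Re}(z)=1/2$ from the right: there is a continuous function $\rho\ge 0$ on $\{\operatorname{Re}(z)>1/2\}$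 such that the expected number of zeros of $f$ in every Borel set $B\subseteq\{\operatorname{Re}(z)>1/2\}$ is $\int_B\rho(z)\,dx\,dy$ (where $z=x+iy$), and $\rho(z)\to\infty$ as $\operatorname{Re}(z)\downarrow 1/2$, uniformly in $\operatorname{Im}(z)$. -/

import Mathlib

open MeasureTheory ProbabilityTheory Filter Topology
open scoped ENNReal NNReal

namespace RandomDirichlet

noncomputable section

/-- The centred complex normal law whose real and imaginary parts are independent normal
variables with mean `0` and the same variance `v`. -/
def complexNormal (v : ℝ≥0) : Measure ℂ :=
  ((gaussianReal 0 v).prod (gaussianReal 0 v)).map Complex.measurableEquivRealProd.symm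

/-- The sum of the first `n` terms of the Dirichlet series `c₀ / 1 ^ z + c₁ / 2 ^ z + ⋯`;
the coefficient of `k ^ (-z)` is stored as `c (k - 1)`. -/
def partialSum (c : ℕ → ℂ) (n : ℕ) (z : ℂ) : ℂ :=
  ∑ k ∈ Finset.range n, c k / ((k + 1 : ℕ) : ℂ) ^ z

/-- The sum of the Dirichlet series, as the limit of its partial sums (the convergence may be
conditional); a meaningful value only where the partial sums converge. -/
def dirichletSum (c : ℕ → ℂ) (z : ℂ) : ℂ :=
  limUnder atTop (fun n => partialSum c n z)

/-- The number of (distinct) zeros of `f` in the set `B`, possibly infinite. -/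
def zeroCount (f : ℂ → ℂ) (B : Set ℂ) : ℝ≥0∞ :=
  (({z | z ∈ B ∧ f z = 0} : Set ℂ).encard : ℝ≥0∞)

/-- The expected number of zeros of the random function `F` in the set `B`. -/
def expectedZeros {Ω : Type*} [MeasurableSpace Ω] (P : Measure Ω) (F : Ω → ℂ → ℂ)
    (B : Set ℂ) : ℝ≥0∞ :=
  ∫⁻ ω, zeroCount (F ω) B ∂P

/-- `ρ` is the (continuous) density, with respect to Lebesgue measure `dx dy`, of the zeros of the
random function `F` in the open set `U`: the expected number of zeros in a Borel set `B ⊆ U` is the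
integral of `ρ` over `B`. -/
structure IsZeroDensity {Ω : Type*} [MeasurableSpace Ω] (P : Measure Ω) (F : Ω → ℂ → ℂ)
    (U : Set ℂ) (ρ : ℂ → ℝ) : Prop where
  continuousOn : ContinuousOn ρ U
  nonneg : ∀ z ∈ U, 0 ≤ ρ z
  expectedZeros_eq : ∀ B : Set ℂ, MeasurableSet B → B ⊆ U →
    expectedZeros P F B = ∫⁻ z in B, ENNReal.ofReal (ρ z)

end

end RandomDirichlet

namespace RandomDirichlet

/-! Write the series as f = a + g, with a the first coefficient and g the independent tail, whose
terms are indexed by (k + 2)^(-z). For fixed g, the zeros of f are the solutions of g(z) = -a. Since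
a has a smooth density p, the area formula with multiplicity (`lintegral_encard_fiber_mul`) turns
the expected number of zeros in B into the integral over B of p(g(z)) |g'(z)|². This is
`lintegral_zeroCount_const_add`; no nondegeneracy of zeros is needed.

Averaging over g and exchanging integrals leaves a pointwise Gaussian computation
(`lintegral_complexNormalPDF_tailFun`). At fixed z the pair (g, g') is Gaussian with second moments
given by A = ζ - 1, B = -ζ' and C = ζ'' at 2 Re z. Subtracting from g' its regression on g makes the
two independent (`map_prod_eq_prod_complexNormal`), and the result is π⁻¹ (C/ζ - B²/ζ²) = π⁻¹
(ζ'/ζ)'(2 Re z). Integrating in Re z gives the rectangle formula. The expansion (ζ'/ζ)'(s) = ∑ Λ(n)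
log n / n^s has nonnegative terms and diverges at s = 1, so the density blows up at the critical
line.

Two analytic points support this. Sub-Gaussian tails and Borel–Cantelli bound the coefficient sums
by O(n^(1/2+ε)) almost surely (`ae_mem_temperedSeq`), and summation by parts then gives locally
uniform convergence, hence holomorphy (`tendstoLocallyUniformlyOn_tailSum`). Measurability of the
zero count comes first on compact sets, where it yields finite expectations, and then extends to
Borel sets. -/

/-! ### The area formula for holomorphic functions -/

theorem abs_det_smul_one (c : ℂ) :
    |(c • (1 : ℂ →L[ℝ] ℂ)).det| = ‖c‖ ^ 2 := by
  have h : (c • (1 : ℂ →L[ℝ] ℂ)).det = ‖c‖ ^ 2 := by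
    rw [ContinuousLinearMap.det, ← LinearMap.det_toMatrix Complex.basisOneI,
      Matrix.det_fin_two, ← Complex.normSq_eq_norm_sq, Complex.normSq_apply]
    simp [LinearMap.toMatrix_apply]
  rw [h, abs_of_nonneg (by positivity)]

theorem hasFDerivAt_real_of_hasDerivAt {g : ℂ → ℂ} {c z : ℂ} (h : HasDerivAt g c z) :
    HasFDerivAt g (c • (1 : ℂ →L[ℝ] ℂ)) z :=
  h.complexToReal_fderiv

theorem exists_injOn_nhds {U : Set ℂ} (hU : IsOpen U) {g : ℂ → ℂ}
    (hg : DifferentiableOn ℂ g U) {z : ℂ} (hz : z ∈ U) (h0 : deriv g z ≠ 0) :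
    ∃ V : Set ℂ, IsOpen V ∧ z ∈ V ∧ Set.InjOn g V := by
  have hs : HasStrictDerivAt g (deriv g z) z :=
    (hg.analyticAt (hU.mem_nhds hz)).hasStrictDerivAt
  let e := (hs.hasStrictFDerivAt_equiv h0).toOpenPartialHomeomorph g
  refine ⟨e.source, e.open_source,
    HasStrictFDerivAt.mem_toOpenPartialHomeomorph_source _, ?_⟩
  exact e.injOn

/-- The inverse function theorem gives a neighbourhood at each noncritical point, and second
countability leaves countably many of them. -/
theorem exists_seq_injOn_cover {U : Set ℂ} (hU : IsOpen U) {g : ℂ → ℂ}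
    (hg : DifferentiableOn ℂ g U) :
    ∃ V : ℕ → Set ℂ, (∀ n, IsOpen (V n)) ∧ (∀ n, Set.InjOn g (V n)) ∧
      ∀ z ∈ U, deriv g z ≠ 0 → ∃ n, z ∈ V n := by
  classical
  have h : ∀ z : ℂ, ∃ V : Set ℂ, IsOpen V ∧ Set.InjOn g V ∧
      (z ∈ U → deriv g z ≠ 0 → z ∈ V) := by
    intro z
    by_cases hz : z ∈ U ∧ deriv g z ≠ 0
    · obtain ⟨V, h1, h2, h3⟩ := exists_injOn_nhds hU hg hz.1 hz.2
      exact ⟨V, h1, h3, fun _ _ => h2⟩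
    · exact ⟨∅, isOpen_empty, Set.injOn_empty _, fun h1 h2 => (hz ⟨h1, h2⟩).elim⟩
  choose V hVo hVi hVm using h
  obtain ⟨t, hts, htc, ht⟩ := TopologicalSpace.countable_cover_nhdsWithin
    (s := {z | z ∈ U ∧ deriv g z ≠ 0}) (f := V)
    (fun z hz => mem_nhdsWithin_of_mem_nhds ((hVo z).mem_nhds (hVm z hz.1 hz.2)))
  rcases t.eq_empty_or_nonempty with rfl | hne
  · refine ⟨fun _ => ∅, fun _ => isOpen_empty, fun _ => Set.injOn_empty _, fun z h1 h2 => ?_⟩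
    simpa using ht ⟨h1, h2⟩
  · obtain ⟨f, rfl⟩ := htc.exists_eq_range hne
    refine ⟨fun n => V (f n), fun n => hVo _, fun n => hVi _, fun z h1 h2 => ?_⟩
    have := ht ⟨h1, h2⟩
    simpa using this

/-- By injectivity each piece contains at most one preimage of `w`, so a piece contributes 0 or 1 to
the count. -/
theorem encard_sep_iUnion_eq_tsum {g : ℂ → ℂ} {A : ℕ → Set ℂ}
    (hd : Pairwise (Function.onFun Disjoint A)) (hi : ∀ n, Set.InjOn g (A n)) (w : ℂ) :
    (({z | z ∈ ⋃ n, A n ∧ g z = w} : Set ℂ).encard : ℝ≥0∞) =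
      ∑' n, (g '' A n).indicator 1 w := by
  have hsub : ∀ n, ({z | z ∈ A n ∧ g z = w} : Set ℂ).Subsingleton :=
    fun n x hx y hy => hi n hx.1 hy.1 (hx.2.trans hy.2.symm)
  have hU : ({z | z ∈ ⋃ n, A n ∧ g z = w} : Set ℂ) = ⋃ n, {z | z ∈ A n ∧ g z = w} := by
    ext z; simp
  have hm : ∀ n, MeasurableSet ({z | z ∈ A n ∧ g z = w} : Set ℂ) := fun n =>
    (hsub n).measurableSet
  rw [← Measure.count_apply (by rw [hU]; exact MeasurableSet.iUnion hm), hU,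
    measure_iUnion (fun i j hij => (hd hij).mono (fun z hz => hz.1) (fun z hz => hz.1)) hm]
  refine tsum_congr fun n => ?_
  rw [Measure.count_apply (hm n)]
  by_cases h : w ∈ g '' A n
  · obtain ⟨z, hz, rfl⟩ := h
    have : ({y | y ∈ A n ∧ g y = g z} : Set ℂ) = {z} :=
      (hsub n).eq_singleton_of_mem ⟨hz, rfl⟩
    rw [this, Set.indicator_of_mem (Set.mem_image_of_mem _ hz)]
    simp
  · have : ({y | y ∈ A n ∧ g y = w} : Set ℂ) = ∅ := by
      ext y
      simp only [Set.mem_ofPred_eq, Set.mem_empty_iff_false, iff_false]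
      exact fun hy => h ⟨y, hy.1, hy.2⟩
    rw [this, Set.indicator_of_notMem h]
    simp

/-- The area formula with multiplicity for a holomorphic function of one variable. -/
theorem lintegral_encard_fiber_mul {U : Set ℂ} (hU : IsOpen U) {g g' : ℂ → ℂ}
    (hg : ∀ z ∈ U, HasDerivAt g (g' z) z) {B : Set ℂ} (hB : MeasurableSet B) (hBU : B ⊆ U)
    {φ : ℂ → ℝ≥0∞} (hφ : Measurable φ) :
    ∫⁻ w, (({z | z ∈ B ∧ g z = w} : Set ℂ).encard : ℝ≥0∞) * φ w =
      ∫⁻ z in B, ENNReal.ofReal (‖g' z‖ ^ 2) * φ (g z) := by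
  have hgd : DifferentiableOn ℂ g U :=
    fun z hz => (hg z hz).differentiableAt.differentiableWithinAt
  have hfd : ∀ z ∈ U, HasFDerivAt g (g' z • (1 : ℂ →L[ℝ] ℂ)) z :=
    fun z hz => hasFDerivAt_real_of_hasDerivAt (hg z hz)
  obtain ⟨V, hVo, hVi, hVc⟩ := exists_seq_injOn_cover hU hgd
  have hZ : MeasurableSet {z | deriv g z = 0} :=
    measurable_deriv g (measurableSet_singleton (0 : ℂ))
  set A : ℕ → Set ℂ := fun n => (B ∩ {z | deriv g z = 0}ᶜ) ∩ disjointed V n with hA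
  have hAm : ∀ n, MeasurableSet (A n) := fun n =>
    (hB.inter hZ.compl).inter (MeasurableSet.disjointed (fun n => (hVo n).measurableSet) n)
  have hAd : Pairwise (Function.onFun Disjoint A) := fun i j hij =>
    (disjoint_disjointed V hij).mono Set.inter_subset_right Set.inter_subset_right
  have hAi : ∀ n, Set.InjOn g (A n) := fun n =>
    (hVi n).mono (Set.inter_subset_right.trans (disjointed_subset V n))
  have hAB : ∀ n, A n ⊆ B := fun n z hz => hz.1.1
  have hAU : ⋃ n, A n = B ∩ {z | deriv g z = 0}ᶜ := by
    rw [hA, ← Set.inter_iUnion, iUnion_disjointed, Set.inter_eq_left]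
    intro z hz
    simpa using hVc z (hBU hz.1) hz.2
  -- Sard: critical values are null, so critical points may be dropped on the left; on the right
  -- their Jacobian factor vanishes.
  have hnull : volume (g '' (B ∩ {z | deriv g z = 0})) = 0 := by
    refine addHaar_image_eq_zero_of_det_fderivWithin_eq_zero volume
      (f' := fun z => g' z • (1 : ℂ →L[ℝ] ℂ))
      (fun z hz => (hfd z (hBU hz.1)).hasFDerivWithinAt) (fun z hz => ?_)
    rw [← abs_eq_zero, abs_det_smul_one, ← (hg z (hBU hz.1)).deriv, hz.2]
    simp
  have hae : ∀ᵐ w : ℂ, (({z | z ∈ B ∧ g z = w} : Set ℂ).encard : ℝ≥0∞) * φ w =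
      ∑' n, (g '' A n).indicator φ w := by
    have : ∀ᵐ w : ℂ, w ∉ g '' (B ∩ {z | deriv g z = 0}) := measure_eq_zero_iff_ae_notMem.1 hnull
    filter_upwards [this] with w hw
    have hset : ({z | z ∈ B ∧ g z = w} : Set ℂ) = {z | z ∈ ⋃ n, A n ∧ g z = w} := by
      ext z
      rw [hAU]
      simp only [Set.mem_ofPred_eq, Set.mem_inter_iff, Set.mem_compl_iff]
      refine ⟨fun h => ⟨⟨h.1, fun h0 => hw ⟨z, ⟨h.1, h0⟩, h.2⟩⟩, h.2⟩, fun h => ⟨h.1.1, h.2⟩⟩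
    rw [hset, encard_sep_iUnion_eq_tsum hAd hAi, ← ENNReal.tsum_mul_right]
    refine tsum_congr fun n => ?_
    by_cases h : w ∈ g '' A n <;> simp [h]
  have himg : ∀ n, MeasurableSet (g '' A n) := fun n =>
    measurable_image_of_fderivWithin (hAm n)
      (fun z hz => (hfd z (hBU (hAB n hz))).hasFDerivWithinAt) (hAi n)
  rw [lintegral_congr_ae hae,
    lintegral_tsum (fun n => (hφ.indicator (himg n)).aemeasurable)]
  have hpiece : ∀ n, ∫⁻ w, (g '' A n).indicator φ w =
      ∫⁻ z in A n, ENNReal.ofReal (‖g' z‖ ^ 2) * φ (g z) := by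
    intro n
    rw [lintegral_indicator (himg n), lintegral_image_eq_lintegral_abs_det_fderiv_mul volume
      (hAm n) (fun z hz => (hfd z (hBU (hAB n hz))).hasFDerivWithinAt) (hAi n)]
    simp_rw [abs_det_smul_one]
  simp_rw [hpiece]
  rw [← lintegral_iUnion hAm hAd, hAU, ← lintegral_inter_add_sdiff (B := {z | deriv g z = 0})
    _ B hZ, Set.sdiff_eq]
  have h0 : ∫⁻ z in B ∩ {z | deriv g z = 0}, ENNReal.ofReal (‖g' z‖ ^ 2) * φ (g z) = 0 := by
    rw [setLIntegral_congr_fun (g := fun _ => 0) (hB.inter hZ), lintegral_zero]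
    intro z hz
    have : g' z = 0 := by rw [← (hg z (hBU hz.1)).deriv]; exact hz.2
    simp [this]
  rw [h0, zero_add]

/-! ### Measurability of the number of zeros -/

/-- A continuous `|H ω|` attains its minimum on `K`, so a zero exists exactly when its values on a
countable dense subset come arbitrarily close to 0. -/
theorem measurableSet_exists_mem_compact_eq_zero {Ω X : Type*} [MeasurableSpace Ω]
    [PseudoMetricSpace X] {K : Set X} (hK : IsCompact K) {H : Ω → X → ℝ}
    (hc : ∀ ω, ContinuousOn (H ω) K) (hm : ∀ x ∈ K, Measurable fun ω => H ω x) :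
    MeasurableSet {ω | ∃ x ∈ K, H ω x = 0} := by
  obtain ⟨D, hDK, hDc, hKD⟩ := hK.isSeparable.exists_countable_dense_subset
  have heq : {ω | ∃ x ∈ K, H ω x = 0} =
      ⋂ n : ℕ, ⋃ d ∈ D, {ω | |H ω d| < 1 / ((n : ℝ) + 1)} := by
    ext ω
    simp only [Set.mem_ofPred_eq, Set.mem_iInter, Set.mem_iUnion, exists_prop]
    constructor
    · rintro ⟨x, hxK, hx⟩ n
      have h1 : Tendsto (fun y => |H ω y|) (𝓝[D] x) (𝓝 0) := by
        have := ((hc ω x hxK).mono hDK).abs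
        rwa [ContinuousWithinAt, hx, abs_zero] at this
      have : (𝓝[D] x).NeBot := mem_closure_iff_nhdsWithin_neBot.1 (hKD hxK)
      obtain ⟨d, hd, hdD⟩ := ((h1.eventually_lt_const (u := 1 / ((n : ℝ) + 1))
        (by positivity)).and self_mem_nhdsWithin).exists
      exact ⟨d, hdD, hd⟩
    · intro h
      obtain ⟨d, hd, -⟩ := h 0
      obtain ⟨x, hxK, hx⟩ := hK.exists_isMinOn ⟨d, hDK hd⟩ (hc ω).abs
      refine ⟨x, hxK, abs_eq_zero.1 (le_antisymm ?_ (abs_nonneg _))⟩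
      refine ge_of_tendsto' tendsto_one_div_add_atTop_nhds_zero_nat fun n => ?_
      obtain ⟨d, hd, hdn⟩ := h n
      exact (hx (hDK hd)).trans hdn.le
  rw [heq]
  exact MeasurableSet.iInter fun n => MeasurableSet.biUnion hDc fun d hd =>
    measurableSet_lt (hm d (hDK hd)).abs measurable_const

theorem natCast_le_encard_iff {α : Type*} {s : Set α} {m : ℕ} :
    (m : ℕ∞) ≤ s.encard ↔ ∃ p : Fin m → α, Function.Injective p ∧ ∀ i, p i ∈ s := by
  constructor
  · intro h
    obtain ⟨t, hts, ht⟩ := Set.exists_subset_encard_eq h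
    have hfin : t.Finite := Set.finite_of_encard_eq_coe ht
    have hcard : Nat.card t = m := by
      rw [Nat.card_coe_set_eq, Set.ncard, ht, ENat.toNat_natCast]
    have : Finite t := hfin
    let e := Finite.equivFinOfCardEq hcard
    exact ⟨fun i => e.symm i, fun i j hij => e.symm.injective (Subtype.ext hij),
      fun i => hts (e.symm i).2⟩
  · rintro ⟨p, hp, hps⟩
    calc (m : ℕ∞) = (Set.range p).encard := by
          rw [← Set.image_univ, hp.encard_image, Set.encard_univ]; simp
      _ ≤ s.encard := Set.encard_le_encard (Set.range_subset_iff.2 hps)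

theorem measurable_zeroCount_of_isCompact {Ω : Type*} [MeasurableSpace Ω] {F : Ω → ℂ → ℂ}
    {K : Set ℂ} (hK : IsCompact K) (hc : ∀ ω, ContinuousOn (F ω) K)
    (hm : ∀ z ∈ K, Measurable fun ω => F ω z) :
    Measurable fun ω => zeroCount (F ω) K := by
  have hle : ∀ m : ℕ, MeasurableSet {ω | (m : ℕ∞) ≤ ({z | z ∈ K ∧ F ω z = 0} : Set ℂ).encard} := by
    intro m
    -- Having `m` distinct zeros is not a closed condition on tuples; imposing a separation `1 / (j
    -- + 1)` makes the tuples a compact set, and the union over `j` recovers distinctness.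
    let C : ℕ → Set (Fin m → ℂ) := fun j =>
      Set.univ.pi (fun _ => K) ∩ {p | ∀ i i', i ≠ i' → 1 / ((j : ℝ) + 1) ≤ dist (p i) (p i')}
    have hC : ∀ j, IsCompact (C j) := by
      intro j
      refine (isCompact_univ_pi fun _ => hK).inter_right ?_
      simp only [Set.ofPred_forall]
      refine isClosed_iInter fun i => isClosed_iInter fun i' => isClosed_iInter fun _ => ?_
      exact isClosed_le continuous_const
        ((continuous_apply i).dist (continuous_apply i'))
    have heq : {ω | (m : ℕ∞) ≤ ({z | z ∈ K ∧ F ω z = 0} : Set ℂ).encard} =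
        ⋃ j, {ω | ∃ p ∈ C j, (∑ i, ‖F ω (p i)‖) = 0} := by
      ext ω
      simp only [Set.mem_ofPred_eq, Set.mem_iUnion, natCast_le_encard_iff]
      constructor
      · rintro ⟨p, hp, hpK⟩
        have hfin : ∃ j : ℕ, ∀ i i', i ≠ i' → 1 / ((j : ℝ) + 1) ≤ dist (p i) (p i') := by
          have : ∀ᶠ j : ℕ in atTop, ∀ i i', i ≠ i' → 1 / ((j : ℝ) + 1) ≤ dist (p i) (p i') := by
            simp only [eventually_all]
            intro i i' hii
            exact (tendsto_one_div_add_atTop_nhds_zero_nat).eventually_le_const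
              (dist_pos.2 (hp.ne hii))
          exact this.exists
        obtain ⟨j, hj⟩ := hfin
        refine ⟨j, p, ⟨fun i _ => (hpK i).1, hj⟩, ?_⟩
        exact Finset.sum_eq_zero fun i _ => by rw [(hpK i).2, norm_zero]
      · rintro ⟨j, p, ⟨hpK, hpd⟩, hp⟩
        rw [Finset.sum_eq_zero_iff_of_nonneg fun _ _ => norm_nonneg _] at hp
        refine ⟨p, fun i i' hii => ?_, fun i => ⟨hpK i trivial, norm_eq_zero.1 (hp i (by simp))⟩⟩
        by_contra hne
        have h1 := hpd i i' hne
        rw [hii, dist_self] at h1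
        exact absurd h1 (not_le.2 (by positivity))
    rw [heq]
    refine MeasurableSet.iUnion fun j => ?_
    refine measurableSet_exists_mem_compact_eq_zero (hC j) (fun ω => ?_) (fun p hp => ?_)
    · refine continuousOn_finsetSum _ fun i _ => ContinuousOn.norm ?_
      exact (hc ω).comp (continuous_apply i).continuousOn fun p hp => hp.1 i trivial
    · exact Finset.measurable_sum _ fun i _ => (hm _ (hp.1 i trivial)).norm
  have hN : Measurable fun ω => ({z | z ∈ K ∧ F ω z = 0} : Set ℂ).encard := by
    rw [ENat.measurable_iff]
    intro n
    have : (fun ω => ({z | z ∈ K ∧ F ω z = 0} : Set ℂ).encard) ⁻¹' {(n : ℕ∞)} =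
        {ω | (n : ℕ∞) ≤ ({z | z ∈ K ∧ F ω z = 0} : Set ℂ).encard} \
          {ω | ((n + 1 : ℕ) : ℕ∞) ≤ ({z | z ∈ K ∧ F ω z = 0} : Set ℂ).encard} := by
      ext ω
      simp only [Set.mem_preimage, Set.mem_singleton_iff, Set.mem_sdiff, Set.mem_ofPred_eq,
        Nat.cast_add, Nat.cast_one, not_le]
      rw [ENat.lt_add_one_iff (ENat.natCast_ne_top n), le_antisymm_iff, and_comm]
    rw [this]
    exact (hle n).diff (hle (n + 1))
  exact (Measurable.of_discrete (f := fun n : ℕ∞ => (n : ℝ≥0∞))).comp hN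

theorem zeroCount_eq_count {f : ℂ → ℂ} {B : Set ℂ} (h : MeasurableSet {z | z ∈ B ∧ f z = 0}) :
    zeroCount f B = Measure.count {z | z ∈ B ∧ f z = 0} :=
  (Measure.count_apply h).symm

/-- If a random continuous function has almost surely finitely many zeros in a compact set, the
number of its zeros in every Borel subset of it is a random variable. -/
theorem aemeasurable_zeroCount_of_subset_isCompact {Ω : Type*} [MeasurableSpace Ω]
    {P : Measure Ω} {F : Ω → ℂ → ℂ} {K : Set ℂ} (hK : IsCompact K)
    (hc : ∀ ω, ContinuousOn (F ω) K) (hm : ∀ z ∈ K, Measurable fun ω => F ω z)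
    (hfin : ∀ᵐ ω ∂P, zeroCount (F ω) K ≠ ∞) {B : Set ℂ} (hB : MeasurableSet B) :
    AEMeasurable (fun ω => zeroCount (F ω) (B ∩ K)) P := by
  classical
  have hZ : ∀ ω, IsClosed {z | z ∈ K ∧ F ω z = 0} := fun ω =>
    (hc ω).preimage_isClosed_of_isClosed hK.isClosed isClosed_singleton
  let S : Set Ω := {ω | zeroCount (F ω) K ≠ ∞}
  have hS : MeasurableSet S :=
    (measurable_zeroCount_of_isCompact hK hc hm (measurableSet_singleton ∞)).compl
  -- The zeros as a random measure, set to 0 where the count is infinite: all values are then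
  -- finite, and measurability passes from the π-system of closed sets to all Borel sets.
  let μ : Ω → Measure ℂ := fun ω =>
    if ω ∈ S then Measure.count.restrict {z | z ∈ K ∧ F ω z = 0} else 0
  have hμ : ∀ ω ∈ S, ∀ A, MeasurableSet A → μ ω A = zeroCount (F ω) (A ∩ K) := by
    intro ω hω A hA
    have hset : A ∩ {z | z ∈ K ∧ F ω z = 0} = {z | z ∈ A ∩ K ∧ F ω z = 0} := by
      ext z
      exact ⟨fun h => ⟨⟨h.1, h.2.1⟩, h.2.2⟩, fun h => ⟨h.1.1, h.1.2, h.2⟩⟩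
    rw [zeroCount_eq_count (hset ▸ hA.inter (hZ ω).measurableSet), ← hset]
    simp only [μ, if_pos hω, Measure.restrict_apply hA]
  have hfinite : ∀ ω, IsFiniteMeasure (μ ω) := by
    intro ω
    by_cases hω : ω ∈ S
    · refine ⟨?_⟩
      rw [hμ ω hω _ MeasurableSet.univ, Set.univ_inter]
      exact lt_top_iff_ne_top.2 hω
    · simp only [μ, if_neg hω]; infer_instance
  have hcl : ∀ A : Set ℂ, IsClosed A → Measurable fun ω => μ ω A := by
    intro A hA
    have h1 : Measurable fun ω => zeroCount (F ω) (A ∩ K) :=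
      measurable_zeroCount_of_isCompact (hK.inter_left hA)
        (fun ω => (hc ω).mono Set.inter_subset_right) (fun z hz => hm z hz.2)
    have h2 : (fun ω => μ ω A) = S.indicator fun ω => zeroCount (F ω) (A ∩ K) := by
      ext ω
      by_cases hω : ω ∈ S
      · rw [Set.indicator_of_mem hω, hμ ω hω A hA.measurableSet]
      · rw [Set.indicator_of_notMem hω]; simp [μ, hω]
    rw [h2]
    exact h1.indicator hS
  have hmeas : Measurable μ := Measurable.measure_of_isPiSystem
    (S := {s | IsClosed s}) (by rw [BorelSpace.measurable_eq (α := ℂ), borel_eq_generateFrom_isClosed])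
    isPiSystem_isClosed (fun A hA => hcl A hA) (hcl _ isClosed_univ)
  refine ⟨fun ω => μ ω B, (Measure.measurable_coe hB).comp hmeas, ?_⟩
  filter_upwards [hfin] with ω hω
  exact (hμ ω hω B hB).symm

/-- Counting measure is continuous from below, so the count is the supremum over the exhaustion. -/
theorem aemeasurable_zeroCount {Ω : Type*} [MeasurableSpace Ω]
    {P : Measure Ω} {F : Ω → ℂ → ℂ} {K : ℕ → Set ℂ} (hK : ∀ n, IsCompact (K n))
    (hmono : Monotone K)
    (hc : ∀ ω n, ContinuousOn (F ω) (K n)) (hm : ∀ n, ∀ z ∈ K n, Measurable fun ω => F ω z)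
    (hfin : ∀ n, ∀ᵐ ω ∂P, zeroCount (F ω) (K n) ≠ ∞) {B : Set ℂ} (hB : MeasurableSet B)
    (hBK : B ⊆ ⋃ n, K n) :
    AEMeasurable (fun ω => zeroCount (F ω) B) P := by
  have hsup : (fun ω => zeroCount (F ω) B) = fun ω => ⨆ n, zeroCount (F ω) (B ∩ K n) := by
    ext ω
    have hm : ∀ n, MeasurableSet {z | z ∈ B ∩ K n ∧ F ω z = 0} := fun n => by
      have : {z | z ∈ B ∩ K n ∧ F ω z = 0} = B ∩ {z | z ∈ K n ∧ F ω z = 0} := by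
        ext z
        exact ⟨fun h => ⟨h.1.1, h.1.2, h.2⟩, fun h => ⟨⟨h.1, h.2.1⟩, h.2.2⟩⟩
      rw [this]
      exact hB.inter ((hc ω n).preimage_isClosed_of_isClosed (hK n).isClosed
        isClosed_singleton).measurableSet
    have hU : {z | z ∈ B ∧ F ω z = 0} = ⋃ n, {z | z ∈ B ∩ K n ∧ F ω z = 0} := by
      ext z
      simp only [Set.mem_iUnion, Set.mem_ofPred_eq]
      refine ⟨fun h => ?_, fun ⟨n, h⟩ => ⟨h.1.1, h.2⟩⟩
      obtain ⟨n, hn⟩ := Set.mem_iUnion.1 (hBK h.1)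
      exact ⟨n, ⟨h.1, hn⟩, h.2⟩
    rw [zeroCount_eq_count (hU ▸ MeasurableSet.iUnion hm), hU, Monotone.measure_iUnion]
    · simp_rw [zeroCount_eq_count (hm _)]
    · exact fun i j hij z hz => ⟨⟨hz.1.1, hmono hij hz.1.2⟩, hz.2⟩
  rw [hsup]
  exact AEMeasurable.iSup fun n =>
    aemeasurable_zeroCount_of_subset_isCompact (hK n) (fun ω => hc ω n) (hm n) (hfin n) hB

/-! ### Convergence of the series by summation by parts -/

/-- The open half-plane to the right of the critical line. -/
abbrev halfPlane : Set ℂ := {z : ℂ | 1 / 2 < z.re}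

theorem isOpen_halfPlane : IsOpen halfPlane :=
  isOpen_lt continuous_const Complex.continuous_re

/-- The sequences whose partial sums are `O(n ^ (1 / 2 + ε))` for every `ε > 0`. -/
def temperedSeq : Set (ℕ → ℂ) :=
  {t | ∀ m : ℕ, ∃ M : ℕ, ∀ n : ℕ,
    ‖∑ k ∈ Finset.range n, t k‖ ≤ M * ((n : ℝ) + 1) ^ (1 / 2 + 1 / ((m : ℝ) + 1))}

/-- Exponents and constants range over ℕ, so only countable unions and intersections occur. -/
theorem measurableSet_temperedSeq : MeasurableSet temperedSeq := by
  simp only [temperedSeq, Set.ofPred_forall, Set.ofPred_exists]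
  refine MeasurableSet.iInter fun m => MeasurableSet.iUnion fun M => MeasurableSet.iInter fun n => ?_
  refine measurableSet_le ?_ measurable_const
  exact (Finset.measurable_sum _ fun k _ => measurable_pi_apply k).norm

/-- The function `z ↦ (k + 2) ^ (-z)`. -/
noncomputable def dirichletTerm (k : ℕ) (z : ℂ) : ℂ := ((k : ℂ) + 2) ^ (-z)

theorem natCast_add_two_ne_zero (k : ℕ) : (k : ℂ) + 2 ≠ 0 := by
  exact_mod_cast (by omega : k + 2 ≠ 0)

theorem norm_dirichletTerm (k : ℕ) (z : ℂ) : ‖dirichletTerm k z‖ = ((k : ℝ) + 2) ^ (-z.re) := by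
  have h := Complex.norm_cpow_eq_rpow_re_of_pos (x := (k : ℝ) + 2) (by positivity) (-z)
  simpa [dirichletTerm] using h

theorem hasDerivAt_dirichletTerm (k : ℕ) (z : ℂ) :
    HasDerivAt (dirichletTerm k) (-(Real.log (k + 2) : ℂ) * dirichletTerm k z) z := by
  have h := (hasDerivAt_neg z).const_cpow (c := (k : ℂ) + 2) (Or.inl (natCast_add_two_ne_zero k))
  have hl : Complex.log ((k : ℂ) + 2) = (Real.log (k + 2) : ℂ) := by
    rw [Complex.ofReal_log (by positivity)]; push_cast; rfl
  rw [hl] at h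
  exact h.congr_deriv (by rw [dirichletTerm]; ring)

/-- The mean value inequality for `u ↦ u ^ (-z)` on `[k + 2, k + 3]`; differencing gains one power
of `k`. -/
theorem norm_dirichletTerm_sub_le (k : ℕ) {z : ℂ} (hz : 0 < z.re) :
    ‖dirichletTerm k z - dirichletTerm (k + 1) z‖ ≤ ‖z‖ * ((k : ℝ) + 2) ^ (-z.re - 1) := by
  have hz0 : z ≠ 0 := by rintro rfl; simp at hz
  have hd : ∀ u ∈ Set.Icc ((k : ℝ) + 2) (k + 3), HasDerivWithinAt (fun u : ℝ => (u : ℂ) ^ (-z))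
      (-z * (u : ℂ) ^ (-z - 1)) (Set.Icc ((k : ℝ) + 2) (k + 3)) u := by
    intro u hu
    have hu0 : u ≠ 0 := by
      have := hu.1
      have : (0 : ℝ) ≤ k := k.cast_nonneg
      linarith
    exact (hasDerivAt_ofReal_cpow_const hu0 (neg_ne_zero.2 hz0)).hasDerivWithinAt
  have hb : ∀ u ∈ Set.Ico ((k : ℝ) + 2) (k + 3), ‖-z * (u : ℂ) ^ (-z - 1)‖ ≤
      ‖z‖ * ((k : ℝ) + 2) ^ (-z.re - 1) := by
    intro u hu
    have hk : (0 : ℝ) < (k : ℝ) + 2 := by positivity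
    rw [norm_mul, norm_neg, Complex.norm_cpow_eq_rpow_re_of_pos (hk.trans_le hu.1)]
    gcongr
    simp only [Complex.sub_re, Complex.neg_re, Complex.one_re]
    exact Real.rpow_le_rpow_of_nonpos hk hu.1 (by linarith)
  have h := norm_image_sub_le_of_norm_deriv_le_segment' hd hb (k + 3)
    ⟨by linarith, le_rfl⟩
  rw [norm_sub_rev]
  simp only [dirichletTerm]
  push_cast at h ⊢
  have e1 : (k : ℂ) + 1 + 2 = k + 3 := by ring
  rw [e1]
  refine h.trans (le_of_eq ?_)
  ring

theorem sum_mul_dirichletTerm_eq (t : ℕ → ℂ) (n : ℕ) (z : ℂ) :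
    ∑ k ∈ Finset.range n, t k * dirichletTerm k z =
      (∑ k ∈ Finset.range n, t k) * dirichletTerm n z +
        ∑ k ∈ Finset.range n, (∑ j ∈ Finset.range (k + 1), t j) *
          (dirichletTerm k z - dirichletTerm (k + 1) z) := by
  induction n with
  | zero => simp
  | succ n ih =>
    rw [Finset.sum_range_succ, ih, Finset.sum_range_succ (fun k => (∑ j ∈ _, t j) * _),
      Finset.sum_range_succ t]
    ring

/-- The sum of `t₀ / 2 ^ z + t₁ / 3 ^ z + ⋯`, written after a summation by parts as an absolutely
convergent series. -/
noncomputable def tailSum (t : ℕ → ℂ) (z : ℂ) : ℂ :=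
  ∑' k, (∑ j ∈ Finset.range (k + 1), t j) * (dirichletTerm k z - dirichletTerm (k + 1) z)

/-- With `α` the growth exponent of the coefficient sums and `x > α` the least real part on the
compact set, the boundary term is `O(n ^ (α - x))` and the summed differences are dominated by the
convergent series of `k ^ (α - x - 1)`. -/
theorem tendstoLocallyUniformlyOn_tailSum {t : ℕ → ℂ} (ht : t ∈ temperedSeq) :
    TendstoLocallyUniformlyOn (fun n z => ∑ k ∈ Finset.range n, t k * dirichletTerm k z)
      (tailSum t) atTop halfPlane := by
  rw [tendstoLocallyUniformlyOn_iff_forall_isCompact isOpen_halfPlane]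
  intro K hKU hK
  rcases K.eq_empty_or_nonempty with rfl | hne
  · exact tendstoUniformlyOn_empty
  obtain ⟨z₀, hz₀, hmin⟩ := hK.exists_isMinOn hne Complex.continuous_re.continuousOn
  set x := z₀.re with hx
  have hx2 : 1 / 2 < x := hKU hz₀
  have hxK : ∀ z ∈ K, x ≤ z.re := fun z hz => hmin hz
  obtain ⟨R, hR⟩ := hK.isBounded.exists_norm_le
  obtain ⟨m, hm⟩ := exists_nat_one_div_lt (sub_pos.2 hx2)
  obtain ⟨M, hM⟩ := ht m
  set α : ℝ := 1 / 2 + 1 / ((m : ℝ) + 1) with hα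
  have hαx : α < x := by linarith
  have hα0 : 0 < α := by positivity
  have h1 : TendstoUniformlyOn
      (fun n z => (∑ k ∈ Finset.range n, t k) * dirichletTerm n z) (fun _ => (0 : ℂ)) atTop K := by
    have hlim : Tendsto (fun n : ℕ => (M : ℝ) * ((n : ℝ) + 2) ^ (-(x - α))) atTop (𝓝 0) := by
      have := (tendsto_rpow_neg_atTop (sub_pos.2 hαx)).comp
        (tendsto_atTop_add_const_right atTop (2 : ℝ) tendsto_natCast_atTop_atTop)
      simpa using this.const_mul (M : ℝ)
    rw [Metric.tendstoUniformlyOn_iff]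
    intro ε hε
    filter_upwards [hlim.eventually_lt_const hε] with n hn z hz
    rw [dist_zero_left, norm_mul, norm_dirichletTerm]
    refine lt_of_le_of_lt ?_ hn
    have hn2 : (0 : ℝ) < (n : ℝ) + 2 := by positivity
    calc ‖∑ k ∈ Finset.range n, t k‖ * ((n : ℝ) + 2) ^ (-z.re)
        ≤ (M * ((n : ℝ) + 2) ^ α) * ((n : ℝ) + 2) ^ (-x) := by
          refine mul_le_mul ((hM n).trans ?_) ?_ (by positivity) (by positivity)
          · gcongr; norm_num
          · exact Real.rpow_le_rpow_of_exponent_le (by linarith [n.cast_nonneg (α := ℝ)])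
              (by linarith [hxK z hz])
      _ = M * ((n : ℝ) + 2) ^ (-(x - α)) := by
          rw [mul_assoc, ← Real.rpow_add hn2]; congr 2; ring
  have h2 : TendstoUniformlyOn (fun n z => ∑ k ∈ Finset.range n,
      (∑ j ∈ Finset.range (k + 1), t j) * (dirichletTerm k z - dirichletTerm (k + 1) z))
      (tailSum t) atTop K := by
    refine tendstoUniformlyOn_tsum_nat
      (u := fun k => M * R * ((k : ℝ) + 2) ^ (α - x - 1)) ?_ fun k z hz => ?_
    · refine Summable.mul_left _ ?_
      have := (summable_nat_add_iff 2).2 (Real.summable_nat_rpow (p := α - x - 1) |>.2 (by linarith))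
      simpa using this
    · have hk2 : (0 : ℝ) < (k : ℝ) + 2 := by positivity
      have hR0 : 0 ≤ R := (norm_nonneg _).trans (hR z hz)
      rw [norm_mul]
      calc _ ≤ (M * ((k : ℝ) + 2) ^ α) * (R * ((k : ℝ) + 2) ^ (-x - 1)) := by
            refine mul_le_mul ((hM (k + 1)).trans (le_of_eq ?_))
              ((norm_dirichletTerm_sub_le k ?_).trans ?_) (norm_nonneg _) (by positivity)
            · push_cast; congr 2; ring
            · linarith [hxK z hz]
            · refine mul_le_mul (hR z hz) ?_ (by positivity) hR0
              exact Real.rpow_le_rpow_of_exponent_le (by linarith [k.cast_nonneg (α := ℝ)])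
                (by linarith [hxK z hz])
        _ = _ := by
            have : α - x - 1 = α + (-x - 1) := by ring
            rw [this, Real.rpow_add hk2 α (-x - 1)]; ring
  have h3 := h1.add h2
  simp only [Pi.add_def, zero_add] at h3
  refine h3.congr (Eventually.of_forall fun n z _ => ?_)
  exact (sum_mul_dirichletTerm_eq t n z).symm

theorem tendsto_tailSum {t : ℕ → ℂ} (ht : t ∈ temperedSeq) {z : ℂ} (hz : z ∈ halfPlane) :
    Tendsto (fun n => ∑ k ∈ Finset.range n, t k * dirichletTerm k z) atTop (𝓝 (tailSum t z)) :=
  (tendstoLocallyUniformlyOn_tailSum ht).tendsto_at hz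

theorem hasDerivAt_sum_dirichletTerm (t : ℕ → ℂ) (n : ℕ) (z : ℂ) :
    HasDerivAt (fun z => ∑ k ∈ Finset.range n, t k * dirichletTerm k z)
      (∑ k ∈ Finset.range n, t k * (-(Real.log (k + 2) : ℂ) * dirichletTerm k z)) z :=
  HasDerivAt.fun_sum fun k _ => (hasDerivAt_dirichletTerm k z).const_mul (t k)

theorem differentiableOn_tailSum {t : ℕ → ℂ} (ht : t ∈ temperedSeq) :
    DifferentiableOn ℂ (tailSum t) halfPlane :=
  (tendstoLocallyUniformlyOn_tailSum ht).differentiableOn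
    (Eventually.of_forall fun n z _ =>
      (hasDerivAt_sum_dirichletTerm t n z).differentiableAt.differentiableWithinAt)
    isOpen_halfPlane

theorem hasDerivAt_tailSum {t : ℕ → ℂ} (ht : t ∈ temperedSeq) {z : ℂ} (hz : z ∈ halfPlane) :
    HasDerivAt (tailSum t) (deriv (tailSum t) z) z :=
  ((differentiableOn_tailSum ht).differentiableAt (isOpen_halfPlane.mem_nhds hz)).hasDerivAt

/-- Weierstrass: locally uniform convergence of holomorphic functions passes to derivatives. This
exhibits the derivative as a linear combination of the coefficients. -/
theorem tendsto_deriv_tailSum {t : ℕ → ℂ} (ht : t ∈ temperedSeq) {z : ℂ} (hz : z ∈ halfPlane) :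
    Tendsto (fun n => ∑ k ∈ Finset.range n, t k * (-(Real.log (k + 2) : ℂ) * dirichletTerm k z))
      atTop (𝓝 (deriv (tailSum t) z)) := by
  have h := ((tendstoLocallyUniformlyOn_tailSum ht).deriv
    (Eventually.of_forall fun n z _ =>
      (hasDerivAt_sum_dirichletTerm t n z).differentiableAt.differentiableWithinAt)
    isOpen_halfPlane).tendsto_at hz
  refine h.congr fun n => ?_
  exact (hasDerivAt_sum_dirichletTerm t n z).deriv

theorem partialSum_succ (c : ℕ → ℂ) (n : ℕ) (z : ℂ) :
    partialSum c (n + 1) z = c 0 + ∑ k ∈ Finset.range n, c (k + 1) * dirichletTerm k z := by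
  rw [partialSum, Finset.sum_range_succ', add_comm]
  congr 1
  · simp
  · refine Finset.sum_congr rfl fun k _ => ?_
    rw [dirichletTerm, Complex.cpow_neg, div_eq_mul_inv]
    congr 3
    push_cast; ring

theorem tendsto_partialSum {c : ℕ → ℂ} (hc : (fun k => c (k + 1)) ∈ temperedSeq) {z : ℂ}
    (hz : z ∈ halfPlane) :
    Tendsto (fun n => partialSum c n z) atTop (𝓝 (c 0 + tailSum (fun k => c (k + 1)) z)) := by
  rw [← tendsto_add_atTop_iff_nat 1]
  simp only [partialSum_succ]
  exact (tendsto_tailSum hc hz).const_add _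

theorem dirichletSum_eq {c : ℕ → ℂ} (hc : (fun k => c (k + 1)) ∈ temperedSeq) {z : ℂ}
    (hz : z ∈ halfPlane) :
    dirichletSum c z = c 0 + tailSum (fun k => c (k + 1)) z :=
  (tendsto_partialSum hc hz).limUnder_eq

/-! ### Almost sure growth of sums of independent normal variables -/

instance (v : ℝ≥0) : IsProbabilityMeasure (complexNormal v) :=
  Measure.isProbabilityMeasure_map (Measurable.aemeasurable (MeasurableEquiv.measurable _))

/-- The law of a sequence of independent complex normal variables. -/
noncomputable abbrev normalSeq (v : ℝ≥0) : Measure (ℕ → ℂ) :=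
  Measure.infinitePi fun _ => complexNormal v

theorem map_re_complexNormal (v : ℝ≥0) :
    (complexNormal v).map Complex.re = gaussianReal 0 v := by
  rw [complexNormal, Measure.map_map Complex.measurable_re (MeasurableEquiv.measurable _)]
  have : Complex.re ∘ Complex.measurableEquivRealProd.symm = Prod.fst := by
    ext p; simp
  rw [this, Measure.map_fst_prod]
  simp

theorem map_im_complexNormal (v : ℝ≥0) :
    (complexNormal v).map Complex.im = gaussianReal 0 v := by
  rw [complexNormal, Measure.map_map Complex.measurable_im (MeasurableEquiv.measurable _)]
  have : Complex.im ∘ Complex.measurableEquivRealProd.symm = Prod.snd := by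
    ext p; simp
  rw [this, Measure.map_snd_prod]
  simp

theorem map_neg_comp_complexNormal {v : ℝ≥0} {l : ℂ → ℝ} (hl : Measurable l)
    (h : (complexNormal v).map l = gaussianReal 0 v) :
    (complexNormal v).map (fun z => -l z) = gaussianReal 0 v := by
  have : (fun z => -l z) = (fun x : ℝ => -x) ∘ l := rfl
  rw [this, ← Measure.map_map measurable_neg hl, h, gaussianReal_map_neg, neg_zero]

theorem summable_exp_neg_mul_rpow {b s : ℝ} (hb : 0 < b) (hs : 0 < s) :
    Summable fun n : ℕ => Real.exp (-b * (n : ℝ) ^ s) := by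
  -- The exponent is chosen so that `(n ^ s) ^ (-2 / s) = n ^ (-2)`, which is summable.
  have h := (isLittleO_exp_neg_mul_rpow_atTop hb (-2 / s)).isBigO.comp_tendsto
    ((tendsto_rpow_atTop hs).comp tendsto_natCast_atTop_atTop)
  refine summable_of_isBigO_nat (Real.summable_nat_rpow.2 (by norm_num : (-2 : ℝ) < -1)) ?_
  refine h.congr (fun n => rfl) fun n => ?_
  simp only [Function.comp_apply]
  rw [← Real.rpow_mul (Nat.cast_nonneg n)]
  congr 1
  field_simp

/-- The sub-Gaussian bound makes the exceptional probabilities at most `exp (-n ^ (2α - 1) / (2v))`,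
summable because `α > 1 / 2`; Borel–Cantelli concludes. -/
theorem ae_eventually_sum_lt {v : ℝ≥0} (hv : v ≠ 0) {l : ℂ → ℝ} (hl : Measurable l)
    (hlaw : (complexNormal v).map l = gaussianReal 0 v) {α : ℝ} (hα : 1 / 2 < α) :
    ∀ᵐ t ∂normalSeq v, ∀ᶠ n : ℕ in atTop, ∑ k ∈ Finset.range n, l (t k) < (n : ℝ) ^ α := by
  have hind : iIndepFun (fun k (t : ℕ → ℂ) => l (t k)) (normalSeq v) :=
    iIndepFun_infinitePi (X := fun _ => l) fun _ => hl
  have hmap : ∀ k, (normalSeq v).map (fun t => l (t k)) = gaussianReal 0 v := by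
    intro k
    have h1 : (fun t : ℕ → ℂ => l (t k)) = l ∘ fun t => t k := rfl
    rw [h1, ← Measure.map_map hl (measurable_pi_apply k), Measure.infinitePi_map_eval, hlaw]
  have hsub : ∀ k, HasSubgaussianMGF (fun t : ℕ → ℂ => l (t k)) v (normalSeq v) := by
    intro k
    refine ⟨fun s => ?_, fun s => ?_⟩
    · have h2 : Integrable (fun x => Real.exp (s * x)) ((normalSeq v).map (fun t => l (t k))) := by
        rw [hmap k]; exact integrable_exp_mul_gaussianReal s
      exact h2.comp_measurable (hl.comp (measurable_pi_apply k))
    · rw [mgf_gaussianReal (hmap k)]; simp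
  have hbound : ∀ n : ℕ, normalSeq v {t | (n : ℝ) ^ α ≤ ∑ k ∈ Finset.range n, l (t k)} ≤
      ENNReal.ofReal (Real.exp (-(1 / (2 * (v : ℝ))) * (n : ℝ) ^ (2 * α - 1))) := by
    intro n
    have hv0 : (0 : ℝ) < v := by exact_mod_cast pos_iff_ne_zero.2 hv
    rw [← ENNReal.ofReal_toReal (measure_ne_top (normalSeq v) _)]
    refine ENNReal.ofReal_le_ofReal ((HasSubgaussianMGF.measure_sum_range_ge_le_of_iIndepFun
      hind (fun i _ => hsub i) (by positivity)).trans ?_)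
    rcases Nat.eq_zero_or_pos n with rfl | hn
    -- At `n = 0` both exponents are 0, the left one through division by zero.
    · simp [Real.zero_rpow (by linarith : (2 * α - 1) ≠ 0)]
    refine le_of_eq ?_
    congr 1
    have hn' : (0 : ℝ) < n := by exact_mod_cast hn
    rw [← Real.rpow_natCast, ← Real.rpow_mul hn'.le, Real.rpow_sub hn', Real.rpow_one]
    push_cast
    rw [mul_comm α 2]
    field_simp
  have hsum : ∑' n : ℕ, normalSeq v {t | (n : ℝ) ^ α ≤ ∑ k ∈ Finset.range n, l (t k)} ≠ ∞ := by
    refine ne_top_of_le_ne_top ?_ (ENNReal.tsum_le_tsum hbound)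
    have hv0 : (0 : ℝ) < v := by exact_mod_cast pos_iff_ne_zero.2 hv
    exact (summable_exp_neg_mul_rpow (by positivity) (by linarith)).tsum_ofReal_ne_top
  filter_upwards [ae_eventually_notMem hsum] with t ht
  filter_upwards [ht] with n hn
  simpa using hn

theorem ae_mem_temperedSeq {v : ℝ≥0} (hv : v ≠ 0) :
    ∀ᵐ t ∂normalSeq v, t ∈ temperedSeq := by
  simp only [temperedSeq, Set.mem_ofPred_eq]
  rw [ae_all_iff]
  intro m
  set α : ℝ := 1 / 2 + 1 / ((m : ℝ) + 1) with hα
  have hα2 : 1 / 2 < α := by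
    have : (0 : ℝ) < 1 / ((m : ℝ) + 1) := by positivity
    linarith
  -- Four one-sided bounds, for the real and imaginary parts and their negatives, control the
  -- modulus.
  filter_upwards [ae_eventually_sum_lt hv Complex.measurable_re (map_re_complexNormal v) hα2,
    ae_eventually_sum_lt hv Complex.measurable_im (map_im_complexNormal v) hα2,
    ae_eventually_sum_lt hv Complex.measurable_re.neg
      (map_neg_comp_complexNormal Complex.measurable_re (map_re_complexNormal v)) hα2,
    ae_eventually_sum_lt hv Complex.measurable_im.neg
      (map_neg_comp_complexNormal Complex.measurable_im (map_im_complexNormal v)) hα2]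
    with t h1 h2 h3 h4
  have hev : ∀ᶠ n : ℕ in atTop,
      ‖∑ k ∈ Finset.range n, t k‖ / ((n : ℝ) + 1) ^ α ≤ 2 := by
    filter_upwards [h1, h2, h3, h4] with n h1 h2 h3 h4
    rw [div_le_iff₀ (by positivity)]
    simp only [Pi.neg_apply, Finset.sum_neg_distrib] at h3 h4
    rw [← Complex.re_sum] at h1 h3
    rw [← Complex.im_sum] at h2 h4
    have h5 : (n : ℝ) ^ α ≤ ((n : ℝ) + 1) ^ α :=
      Real.rpow_le_rpow (by positivity) (by linarith) (by linarith)
    have h6 := Complex.norm_le_abs_re_add_abs_im (∑ k ∈ Finset.range n, t k)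
    have h7 : |(∑ k ∈ Finset.range n, t k).re| ≤ (n : ℝ) ^ α := abs_le.2 ⟨by linarith, h1.le⟩
    have h8 : |(∑ k ∈ Finset.range n, t k).im| ≤ (n : ℝ) ^ α := abs_le.2 ⟨by linarith, h2.le⟩
    linarith
  -- The finitely many exceptional `n` are absorbed into the constant.
  have hbdd : BddAbove (Set.range fun n : ℕ =>
      ‖∑ k ∈ Finset.range n, t k‖ / ((n : ℝ) + 1) ^ α) :=
    IsBoundedUnder.bddAbove_range ⟨2, by simpa using hev⟩
  obtain ⟨C, hC⟩ := hbdd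
  obtain ⟨M, hM⟩ := exists_nat_ge C
  refine ⟨M, fun n => ?_⟩
  have := (hC (Set.mem_range_self n)).trans hM
  rwa [div_le_iff₀ (by positivity)] at this

/-! ### Characteristic functions and independence of orthogonal combinations -/

theorem charFunDual_complexNormal (v : ℝ≥0) (L : StrongDual ℝ ℂ) :
    charFunDual (complexNormal v) L =
      Complex.exp (-((v / 2 * (L 1 ^ 2 + L Complex.I ^ 2) : ℝ) : ℂ)) := by
  have hg : ∀ L : StrongDual ℝ ℝ, charFunDual (gaussianReal 0 v) L =
      Complex.exp (-((v / 2 * (L 1 ^ 2) : ℝ) : ℂ)) := by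
    intro L
    have h1 : charFunDual (gaussianReal 0 v) L = charFun (gaussianReal 0 v) (L 1) := by
      rw [charFunDual_apply, charFun_apply_real]
      congr with x
      have : L x = x * L 1 := by
        conv_lhs => rw [← mul_one x, ← smul_eq_mul, map_smul, smul_eq_mul]
      rw [this]; push_cast; ring_nf
    rw [h1, charFun_gaussianReal]
    congr 1
    push_cast; ring
  have hmap : complexNormal v = ((gaussianReal 0 v).prod (gaussianReal 0 v)).map
      (Complex.equivRealProdCLM.symm : ℝ × ℝ →L[ℝ] ℂ) := rfl
  rw [hmap, charFunDual_map, charFunDual_prod, hg, hg, ← Complex.exp_add]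
  congr 1
  simp [Complex.equivRealProdCLM_symm_apply]
  ring

/-- In this form a functional of a linear combination is absorbed into its complex coefficients. -/
theorem eq_re_mul_of_strongDual (L : StrongDual ℝ ℂ) (z : ℂ) :
    L z = (((L 1 : ℂ) - L Complex.I * Complex.I) * z).re := by
  have h : z = z.re • (1 : ℂ) + z.im • Complex.I := by simp
  conv_lhs => rw [h, map_add, map_smul, map_smul]
  simp
  ring

/-- The characteristic function of a finite linear combination of independent complex normal
variables. -/
theorem integral_exp_sum_normalSeq (v : ℝ≥0) (d : ℕ → ℂ) (n : ℕ) :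
    ∫ t, Complex.exp ((∑ k ∈ Finset.range n, t k * d k).re * Complex.I) ∂normalSeq v =
      Complex.exp (-((v / 2 * ∑ k ∈ Finset.range n, ‖d k‖ ^ 2 : ℝ) : ℂ)) := by
  let L : ℕ → StrongDual ℝ ℂ := fun k =>
    Complex.reCLM.comp ((ContinuousLinearMap.mul ℝ ℂ).flip (d k))
  have hL : ∀ k z, L k z = (z * d k).re := fun k z => rfl
  have hind : iIndepFun (fun k (t : ℕ → ℂ) => L k (t k)) (normalSeq v) :=
    iIndepFun_infinitePi (X := fun k z => L k z) fun k => (L k).measurable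
  have hm : ∀ k, Measurable fun t : ℕ → ℂ => L k (t k) := fun k =>
    (L k).measurable.comp (measurable_pi_apply k)
  have hcf := congrFun (iIndepFun.charFun_map_fun_finsetSum_eq_prod (s := Finset.range n)
    (fun k _ => (hm k).aemeasurable) (hind.restrict _)) 1
  rw [Finset.prod_apply, charFun_apply_real, integral_map
    (Finset.measurable_sum _ fun k _ => hm k).aemeasurable (by fun_prop)] at hcf
  have h1 : ∀ k, charFun ((normalSeq v).map fun t => L k (t k)) 1 =
      Complex.exp (-((v / 2 * ‖d k‖ ^ 2 : ℝ) : ℂ)) := by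
    intro k
    have h2 : (fun t : ℕ → ℂ => L k (t k)) = (L k) ∘ fun t => t k := rfl
    rw [h2, ← Measure.map_map (L k).measurable (measurable_pi_apply k),
      Measure.infinitePi_map_eval, ← charFunDual_eq_charFun_map_one, charFunDual_complexNormal,
      hL, hL, ← Complex.normSq_eq_norm_sq, Complex.normSq_apply]
    have h3 : (1 * d k).re ^ 2 + (Complex.I * d k).re ^ 2 =
        (d k).re * (d k).re + (d k).im * (d k).im := by
      simp only [one_mul, Complex.I_mul_re]; ring
    rw [h3]
  simp_rw [h1, ← Complex.exp_sum] at hcf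
  rw [Finset.mul_sum, Complex.ofReal_sum, ← Finset.sum_neg_distrib, ← hcf]
  congr with t
  simp [hL]

/-- Dominated convergence from finite sums, the integrands having modulus 1. -/
theorem integral_exp_re_of_tendsto {v : ℝ≥0} {d : ℕ → ℂ} {σ : ℝ} (hd : HasSum (fun k => ‖d k‖ ^ 2) σ)
    {X : (ℕ → ℂ) → ℂ}
    (hlim : ∀ᵐ t ∂normalSeq v, Tendsto (fun n => ∑ k ∈ Finset.range n, t k * d k) atTop (𝓝 (X t))) :
    ∫ t, Complex.exp ((X t).re * Complex.I) ∂normalSeq v =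
      Complex.exp (-((v / 2 * σ : ℝ) : ℂ)) := by
  have h1 : Tendsto (fun n => ∫ t, Complex.exp ((∑ k ∈ Finset.range n, t k * d k).re * Complex.I)
      ∂normalSeq v) atTop (𝓝 (∫ t, Complex.exp ((X t).re * Complex.I) ∂normalSeq v)) := by
    refine tendsto_integral_of_dominated_convergence (fun _ => 1) (fun n => ?_)
      (integrable_const _) (fun n => ?_) ?_
    · refine Measurable.aestronglyMeasurable ?_
      have : Measurable fun t : ℕ → ℂ => ∑ k ∈ Finset.range n, t k * d k :=
        Finset.measurable_sum _ fun k _ => (measurable_pi_apply k).mul_const _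
      fun_prop
    · exact Eventually.of_forall fun t => by rw [Complex.norm_exp_ofReal_mul_I]
    · filter_upwards [hlim] with t ht
      exact ((Complex.continuous_exp.comp (by fun_prop :
        Continuous fun z : ℂ => (z.re : ℂ) * Complex.I)).tendsto _).comp ht
  simp_rw [integral_exp_sum_normalSeq] at h1
  refine tendsto_nhds_unique h1 ?_
  refine (Complex.continuous_exp.tendsto _).comp ?_
  refine Tendsto.neg ((Complex.continuous_ofReal.tendsto _).comp ?_)
  exact hd.tendsto_sum_nat.const_mul _

/-- Orthogonal square-summable linear combinations of independent complex normal variables are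
independent complex normal variables. -/
theorem map_prod_eq_prod_complexNormal {v A D : ℝ≥0} {b c : ℕ → ℂ}
    (hb : HasSum (fun k => ‖b k‖ ^ 2) A) (hc : HasSum (fun k => ‖c k‖ ^ 2) D)
    (hbc : HasSum (fun k => b k * (starRingEnd ℂ) (c k)) 0) {X Y : (ℕ → ℂ) → ℂ}
    (hX : Measurable X) (hY : Measurable Y)
    (hXlim : ∀ᵐ t ∂normalSeq v,
      Tendsto (fun n => ∑ k ∈ Finset.range n, t k * b k) atTop (𝓝 (X t)))
    (hYlim : ∀ᵐ t ∂normalSeq v,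
      Tendsto (fun n => ∑ k ∈ Finset.range n, t k * c k) atTop (𝓝 (Y t))) :
    (normalSeq v).map (fun t => (X t, Y t)) =
      (complexNormal (v * A)).prod (complexNormal (v * D)) := by
  have : IsProbabilityMeasure ((normalSeq v).map (fun t => (X t, Y t))) :=
    Measure.isProbabilityMeasure_map (hX.prodMk hY).aemeasurable
  refine Measure.ext_of_charFunDual (funext fun L => ?_)
  set L₁ : StrongDual ℝ ℂ := L.comp (.inl ℝ ℂ ℂ)
  set L₂ : StrongDual ℝ ℂ := L.comp (.inr ℝ ℂ ℂ)
  set p : ℂ := (L₁ 1 : ℂ) - L₁ Complex.I * Complex.I with hp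
  set q : ℂ := (L₂ 1 : ℂ) - L₂ Complex.I * Complex.I with hq
  have hL : ∀ x y, L (x, y) = (p * x + q * y).re := by
    intro x y
    have : L (x, y) = L₁ x + L₂ y := by
      simp [L₁, L₂, ← map_add]
    rw [this, eq_re_mul_of_strongDual L₁, eq_re_mul_of_strongDual L₂, Complex.add_re]
  have hpn : ‖p‖ ^ 2 = L₁ 1 ^ 2 + L₁ Complex.I ^ 2 := by
    rw [← Complex.normSq_eq_norm_sq, Complex.normSq_apply]; simp [hp]; ring
  have hqn : ‖q‖ ^ 2 = L₂ 1 ^ 2 + L₂ Complex.I ^ 2 := by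
    rw [← Complex.normSq_eq_norm_sq, Complex.normSq_apply]; simp [hq]; ring
  -- Orthogonality kills the cross term, so the joint characteristic function factors.
  have hd : HasSum (fun k => ‖p * b k + q * c k‖ ^ 2) (‖p‖ ^ 2 * A + ‖q‖ ^ 2 * D) := by
    have h1 := ((hb.mul_left (‖p‖ ^ 2)).add (hc.mul_left (‖q‖ ^ 2))).add
      ((Complex.hasSum_re (hbc.mul_left (p * (starRingEnd ℂ) q))).mul_left 2)
    simp only [mul_zero, Complex.zero_re, add_zero] at h1
    have he : (fun k => ‖p * b k + q * c k‖ ^ 2) = fun k =>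
        ‖p‖ ^ 2 * ‖b k‖ ^ 2 + ‖q‖ ^ 2 * ‖c k‖ ^ 2 +
          2 * (p * (starRingEnd ℂ) q * (b k * (starRingEnd ℂ) (c k))).re := by
      funext k
      simp only [← Complex.normSq_eq_norm_sq]
      rw [Complex.normSq_add, Complex.normSq_mul, Complex.normSq_mul, map_mul]
      congr 3
      ring
    rw [he]
    exact h1
  rw [charFunDual_prod, charFunDual_complexNormal, charFunDual_complexNormal, charFunDual_apply,
    integral_map (hX.prodMk hY).aemeasurable (by fun_prop), ← Complex.exp_add]
  simp_rw [hL]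
  rw [integral_exp_re_of_tendsto hd]
  · rw [hpn, hqn, ← Complex.ofReal_neg, ← Complex.ofReal_neg, ← Complex.ofReal_neg,
      ← Complex.ofReal_add, NNReal.coe_mul, NNReal.coe_mul]
    congr 2
    ring
  · filter_upwards [hXlim, hYlim] with t h1 h2
    refine ((h1.const_mul p).add (h2.const_mul q)).congr fun n => ?_
    rw [Finset.mul_sum, Finset.mul_sum, ← Finset.sum_add_distrib]
    exact Finset.sum_congr rfl fun k _ => by ring

/-! ### Gaussian integrals -/

/-- The density of `complexNormal v`. -/
noncomputable def complexNormalPDF (v : ℝ≥0) (w : ℂ) : ℝ :=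
  (2 * Real.pi * v)⁻¹ * Real.exp (-‖w‖ ^ 2 / (2 * v))

theorem complexNormalPDF_nonneg (v : ℝ≥0) (w : ℂ) : 0 ≤ complexNormalPDF v w := by
  unfold complexNormalPDF; positivity

theorem complexNormalPDF_neg (v : ℝ≥0) (w : ℂ) :
    complexNormalPDF v (-w) = complexNormalPDF v w := by
  simp [complexNormalPDF]

theorem measurable_complexNormalPDF (v : ℝ≥0) : Measurable (complexNormalPDF v) := by
  unfold complexNormalPDF; fun_prop

theorem gaussianPDFReal_mul_gaussianPDFReal (v : ℝ≥0) (w : ℂ) :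
    gaussianPDFReal 0 v w.re * gaussianPDFReal 0 v w.im = complexNormalPDF v w := by
  have hs : √(2 * Real.pi * v) * √(2 * Real.pi * v) = 2 * Real.pi * v :=
    Real.mul_self_sqrt (by positivity)
  rw [gaussianPDFReal, gaussianPDFReal, complexNormalPDF, mul_mul_mul_comm, ← mul_inv, hs,
    ← Real.exp_add, ← Complex.normSq_eq_norm_sq, Complex.normSq_apply]
  congr 2
  ring

theorem lintegral_complexNormal {v : ℝ≥0} (hv : v ≠ 0) {φ : ℂ → ℝ≥0∞} (hφ : Measurable φ) :
    ∫⁻ w, φ w ∂complexNormal v = ∫⁻ w, ENNReal.ofReal (complexNormalPDF v w) * φ w := by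
  have hvp := Complex.volume_preserving_equiv_real_prod
  have hφ' : Measurable fun p => φ (Complex.measurableEquivRealProd.symm p) :=
    hφ.comp (MeasurableEquiv.measurable _)
  rw [complexNormal, lintegral_map hφ (MeasurableEquiv.measurable _),
    gaussianReal_of_var_ne_zero 0 hv,
    prod_withDensity (measurable_gaussianPDF 0 v) (measurable_gaussianPDF 0 v),
    lintegral_withDensity_eq_lintegral_mul _ (by fun_prop) hφ', ← Measure.volume_eq_prod,
    ← hvp.lintegral_comp (by fun_prop)]
  refine lintegral_congr fun w => ?_
  simp only [Pi.mul_apply, Complex.measurableEquivRealProd_apply]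
  rw [gaussianPDF, gaussianPDF, ← ENNReal.ofReal_mul (gaussianPDFReal_nonneg _ _ _),
    gaussianPDFReal_mul_gaussianPDFReal]
  congr 2

/-- Inverse variances add in the exponent; the constant is the density of `complexNormal (v + s)` at
0. -/
theorem complexNormalPDF_mul {v s : ℝ≥0} (hv : v ≠ 0) (hs : s ≠ 0) (w : ℂ) :
    complexNormalPDF s w * complexNormalPDF v w =
      (2 * Real.pi * (v + s))⁻¹ * complexNormalPDF (v * s / (v + s)) w := by
  have hv0 : (0 : ℝ) < v := by exact_mod_cast pos_iff_ne_zero.2 hv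
  have hs0 : (0 : ℝ) < s := by exact_mod_cast pos_iff_ne_zero.2 hs
  have he : Real.exp (-‖w‖ ^ 2 / (2 * ((v * s / (v + s) : ℝ≥0) : ℝ))) =
      Real.exp (-‖w‖ ^ 2 / (2 * s)) * Real.exp (-‖w‖ ^ 2 / (2 * v)) := by
    rw [← Real.exp_add]
    congr 1
    push_cast
    field_simp
    ring
  rw [complexNormalPDF, complexNormalPDF, complexNormalPDF, he]
  push_cast
  field_simp

theorem lintegral_complexNormalPDF_mul {v s : ℝ≥0} (hv : v ≠ 0) (hs : s ≠ 0) {φ : ℂ → ℝ≥0∞}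
    (hφ : Measurable φ) :
    ∫⁻ w, ENNReal.ofReal (complexNormalPDF v w) * φ w ∂complexNormal s =
      ENNReal.ofReal (2 * Real.pi * (v + s))⁻¹ *
        ∫⁻ w, φ w ∂complexNormal (v * s / (v + s)) := by
  have hvs : v * s / (v + s) ≠ 0 :=
    div_ne_zero (mul_ne_zero hv hs) (fun h => hv (add_eq_zero.1 h).1)
  have hm : ∀ v, Measurable fun w => ENNReal.ofReal (complexNormalPDF v w) * φ w := fun v =>
    (measurable_complexNormalPDF v).ennreal_ofReal.mul hφ
  rw [lintegral_complexNormal hs (hm v),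
    lintegral_complexNormal hvs hφ, ← lintegral_const_mul _ (hm _)]
  refine lintegral_congr fun w => ?_
  rw [← mul_assoc, ← mul_assoc, ← ENNReal.ofReal_mul (complexNormalPDF_nonneg _ _),
    complexNormalPDF_mul hv hs, ENNReal.ofReal_mul (by positivity)]

theorem lintegral_add_sq_gaussianReal (r : ℝ≥0) (c : ℝ) :
    ∫⁻ x, ENNReal.ofReal ((c + x) ^ 2) ∂gaussianReal 0 r = ENNReal.ofReal (c ^ 2 + r) := by
  have h2 : MemLp (fun x : ℝ => x) 2 (gaussianReal 0 r) := memLp_id_gaussianReal 2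
  have h1 : Integrable (fun x : ℝ => x) (gaussianReal 0 r) := h2.integrable (by norm_num)
  have h3 : Integrable (fun x : ℝ => x ^ 2) (gaussianReal 0 r) := h2.integrable_sq
  have h4 : (fun x : ℝ => (c + x) ^ 2) = fun x => (c ^ 2 + 2 * c * x) + x ^ 2 := by
    ext x; ring
  have h5 : Integrable (fun x : ℝ => c ^ 2 + 2 * c * x) (gaussianReal 0 r) :=
    (integrable_const _).add (h1.const_mul _)
  have h6 : ∫ x, x ^ 2 ∂gaussianReal 0 r = r := by
    have := variance_fun_id_gaussianReal (μ := 0) (v := r)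
    rw [variance_eq_sub h2] at this
    simpa using this
  rw [← ofReal_integral_eq_lintegral_ofReal (by rw [h4]; exact h5.add h3)
    (Eventually.of_forall fun x => sq_nonneg _), h4, integral_add h5 h3,
    integral_add (integrable_const _) (h1.const_mul _), integral_const_mul, h6]
  simp

theorem lintegral_norm_add_sq_complexNormal (r : ℝ≥0) (a : ℂ) :
    ∫⁻ h, ENNReal.ofReal (‖a + h‖ ^ 2) ∂complexNormal r = ENNReal.ofReal (‖a‖ ^ 2 + 2 * r) := by
  rw [complexNormal, lintegral_map (by fun_prop) (MeasurableEquiv.measurable _)]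
  have h1 : ∀ p : ℝ × ℝ, ENNReal.ofReal (‖a + Complex.measurableEquivRealProd.symm p‖ ^ 2) =
      ENNReal.ofReal ((a.re + p.1) ^ 2) + ENNReal.ofReal ((a.im + p.2) ^ 2) := by
    intro p
    rw [← ENNReal.ofReal_add (sq_nonneg _) (sq_nonneg _), ← Complex.normSq_eq_norm_sq,
      Complex.normSq_apply]
    congr 1
    simp
    ring
  simp_rw [h1]
  rw [lintegral_add_left (by fun_prop), lintegral_prod _ (by fun_prop),
    lintegral_prod _ (by fun_prop)]
  simp only [lintegral_const, measure_univ, mul_one, lintegral_add_sq_gaussianReal]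
  rw [← ENNReal.ofReal_add (by positivity) (by positivity), ← Complex.normSq_eq_norm_sq,
    Complex.normSq_apply]
  congr 1
  ring

/-- With `p.1` the tail and `β * p.1 + p.2` its derivative, the right side is the density of the
full series at 0 times the conditional second moment of its derivative given a zero: conditioning
shrinks the variance `s` to `v * s / (v + s)` and leaves `r` unchanged. -/
theorem lintegral_complexNormalPDF_mul_norm_sq {v s r : ℝ≥0} (hv : v ≠ 0) (hs : s ≠ 0) (β : ℂ) :
    ∫⁻ p, ENNReal.ofReal (complexNormalPDF v p.1) * ENNReal.ofReal (‖β * p.1 + p.2‖ ^ 2)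
        ∂(complexNormal s).prod (complexNormal r) =
      ENNReal.ofReal ((2 * Real.pi * (v + s))⁻¹ *
        (‖β‖ ^ 2 * (2 * (v * s / (v + s))) + 2 * r)) := by
  have hn : Measurable fun p : ℂ × ℂ => ENNReal.ofReal (‖β * p.1 + p.2‖ ^ 2) :=
    ((((measurable_fst.const_mul β).add measurable_snd).norm).pow_const 2).ennreal_ofReal
  have hm : Measurable fun p : ℂ × ℂ => ENNReal.ofReal (complexNormalPDF v p.1) :=
    (measurable_complexNormalPDF v).ennreal_ofReal.comp measurable_fst
  have hmn : Measurable fun p : ℂ × ℂ => ENNReal.ofReal (complexNormalPDF v p.1) *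
      ENNReal.ofReal (‖β * p.1 + p.2‖ ^ 2) := hm.mul hn
  rw [lintegral_prod _ hmn.aemeasurable]
  simp only
  have h1 : ∀ w : ℂ, ∫⁻ h, ENNReal.ofReal (complexNormalPDF v w) *
      ENNReal.ofReal (‖β * w + h‖ ^ 2) ∂complexNormal r =
      ENNReal.ofReal (complexNormalPDF v w) * ENNReal.ofReal (‖β * w‖ ^ 2 + 2 * r) := by
    intro w
    have hq : Measurable fun h : ℂ => ENNReal.ofReal (‖β * w + h‖ ^ 2) := by fun_prop
    rw [lintegral_const_mul _ hq, lintegral_norm_add_sq_complexNormal]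
  simp_rw [h1]
  rw [lintegral_complexNormalPDF_mul hv hs (by fun_prop), ENNReal.ofReal_mul (by positivity)]
  congr 1
  have h2 : ∀ w : ℂ, ENNReal.ofReal (‖β * w‖ ^ 2 + 2 * r) =
      ENNReal.ofReal (‖β‖ ^ 2) * ENNReal.ofReal (‖0 + w‖ ^ 2) + ENNReal.ofReal (2 * r) := by
    intro w
    rw [← ENNReal.ofReal_mul (by positivity), ← ENNReal.ofReal_add (by positivity) (by positivity),
      norm_mul, mul_pow, zero_add]
  simp_rw [h2]
  rw [lintegral_add_left (by fun_prop), lintegral_const_mul _ (by fun_prop),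
    lintegral_norm_add_sq_complexNormal, ← ENNReal.ofReal_mul (by positivity)]
  simp only [lintegral_const, measure_univ, mul_one]
  rw [← ENNReal.ofReal_add (by positivity) (by positivity)]
  congr 1
  push_cast
  simp

/-! ### The logarithmic derivative of zeta as a Dirichlet series -/

open LSeries in
theorem term_ofReal (f : ℕ → ℝ) (x : ℝ) (n : ℕ) :
    term (fun n => (f n : ℂ)) x n = ((if n = 0 then 0 else f n * (n : ℝ) ^ (-x) : ℝ) : ℂ) := by
  rcases eq_or_ne n 0 with rfl | hn
  · simp
  rw [term_of_ne_zero hn, if_neg hn, Complex.ofReal_mul, Complex.ofReal_cpow (Nat.cast_nonneg n),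
    Complex.ofReal_neg, Complex.cpow_neg, Complex.ofReal_natCast, div_eq_mul_inv]

theorem LSeries_ofReal_eq (f : ℕ → ℝ) (x : ℝ) :
    LSeries (fun n => (f n : ℂ)) x =
      ((∑' n : ℕ, if n = 0 then 0 else f n * (n : ℝ) ^ (-x) : ℝ) : ℂ) := by
  rw [LSeries, Complex.ofReal_tsum]
  exact tsum_congr fun n => term_ofReal f x n

theorem hasSum_re_LSeries_ofReal {f : ℕ → ℝ} {x : ℝ}
    (h : LSeriesSummable (fun n => (f n : ℂ)) x) :
    HasSum (fun n : ℕ => if n = 0 then 0 else f n * (n : ℝ) ^ (-x))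
      (LSeries (fun n => (f n : ℂ)) x).re := by
  have h1 := Complex.hasSum_re h.LSeriesHasSum
  simpa only [term_ofReal, Complex.ofReal_re] using h1

/-- Dropping the indices 0 and 1 matches the tail without its first coefficient. -/
theorem hasSum_re_LSeries_ofReal_add_two {f : ℕ → ℝ} {x : ℝ}
    (h : LSeriesSummable (fun n => (f n : ℂ)) x) :
    HasSum (fun k : ℕ => f (k + 2) * ((k : ℝ) + 2) ^ (-x))
      ((LSeries (fun n => (f n : ℂ)) x).re - f 1) := by
  have h1 := (hasSum_nat_add_iff' 2).2 (hasSum_re_LSeries_ofReal h)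
  simpa [Finset.sum_range_succ] using h1

theorem logMul_ofReal (f : ℕ → ℝ) :
    LSeries.logMul (fun n => (f n : ℂ)) = fun n : ℕ => ((Real.log n * f n : ℝ) : ℂ) := by
  ext n
  rw [LSeries.logMul, Complex.ofReal_mul, Complex.natCast_log]

theorem isOpen_one_lt_re : IsOpen {s : ℂ | 1 < s.re} :=
  isOpen_lt continuous_const Complex.continuous_re

theorem abscissa_one_lt {s : ℂ} (hs : 1 < s.re) :
    LSeries.abscissaOfAbsConv (fun _ => ((1 : ℝ) : ℂ)) < s.re := by
  have h : (fun _ : ℕ => ((1 : ℝ) : ℂ)) = 1 := by ext; simp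
  rw [h, LSeries.abscissaOfAbsConv_one]
  exact_mod_cast hs

theorem riemannZeta_eq_LSeries {s : ℂ} (hs : 1 < s.re) :
    riemannZeta s = LSeries (fun _ => ((1 : ℝ) : ℂ)) s := by
  have h : (fun _ : ℕ => ((1 : ℝ) : ℂ)) = 1 := by ext; simp
  rw [h, LSeries_one_eq_riemannZeta hs]

theorem hasDerivAt_riemannZeta {s : ℂ} (hs : 1 < s.re) :
    HasDerivAt riemannZeta (-LSeries (fun n : ℕ => ((Real.log n * 1 : ℝ) : ℂ)) s) s := by
  have h := LSeries_hasDerivAt (abscissa_one_lt hs)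
  rw [logMul_ofReal] at h
  refine h.congr_of_eventuallyEq ?_
  filter_upwards [isOpen_one_lt_re.mem_nhds hs] with w hw using riemannZeta_eq_LSeries hw

theorem abscissa_log_lt {s : ℂ} (hs : 1 < s.re) :
    LSeries.abscissaOfAbsConv (fun n : ℕ => ((Real.log n * 1 : ℝ) : ℂ)) < s.re := by
  rw [← logMul_ofReal, LSeries.abscissaOfAbsConv_logMul]
  exact abscissa_one_lt hs

theorem abscissa_log_sq_lt {s : ℂ} (hs : 1 < s.re) :
    LSeries.abscissaOfAbsConv (fun n : ℕ => ((Real.log n * (Real.log n * 1) : ℝ) : ℂ)) < s.re := by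
  rw [← logMul_ofReal (fun n : ℕ => Real.log n * 1), LSeries.abscissaOfAbsConv_logMul]
  exact abscissa_log_lt hs

theorem hasDerivAt_deriv_riemannZeta {s : ℂ} (hs : 1 < s.re) :
    HasDerivAt (deriv riemannZeta)
      (LSeries (fun n : ℕ => ((Real.log n * (Real.log n * 1) : ℝ) : ℂ)) s) s := by
  have h := (LSeries_hasDerivAt (abscissa_log_lt hs)).neg
  rw [logMul_ofReal (fun n : ℕ => Real.log n * 1), neg_neg] at h
  refine h.congr_of_eventuallyEq ?_
  filter_upwards [isOpen_one_lt_re.mem_nhds hs] with w hw using (hasDerivAt_riemannZeta hw).deriv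

/-- The derivative `∑ Λ(n) log n / n ^ s` of the logarithmic derivative of the zeta function. -/
noncomputable def zetaLogDerivDeriv (s : ℂ) : ℂ :=
  LSeries (fun n : ℕ => ((Real.log n * ArithmeticFunction.vonMangoldt n : ℝ) : ℂ)) s

theorem abscissa_vonMangoldt_lt {s : ℂ} (hs : 1 < s.re) :
    LSeries.abscissaOfAbsConv (fun n : ℕ => (ArithmeticFunction.vonMangoldt n : ℂ)) < s.re := by
  refine lt_of_le_of_lt (LSeries.abscissaOfAbsConv_le_of_forall_lt_LSeriesSummable (x := 1)
    fun y hy => ArithmeticFunction.LSeriesSummable_vonMangoldt (by simpa using hy)) ?_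
  exact_mod_cast hs

theorem abscissa_log_vonMangoldt_lt {s : ℂ} (hs : 1 < s.re) :
    LSeries.abscissaOfAbsConv
      (fun n : ℕ => ((Real.log n * ArithmeticFunction.vonMangoldt n : ℝ) : ℂ)) < s.re := by
  rw [← logMul_ofReal (fun n : ℕ => ArithmeticFunction.vonMangoldt n),
    LSeries.abscissaOfAbsConv_logMul]
  exact abscissa_vonMangoldt_lt hs

theorem hasDerivAt_logDeriv_riemannZeta {s : ℂ} (hs : 1 < s.re) :
    HasDerivAt (fun s => deriv riemannZeta s / riemannZeta s) (zetaLogDerivDeriv s) s := by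
  have h := (LSeries_hasDerivAt (abscissa_vonMangoldt_lt hs)).neg
  rw [logMul_ofReal (fun n : ℕ => ArithmeticFunction.vonMangoldt n), neg_neg] at h
  refine h.congr_of_eventuallyEq ?_
  filter_upwards [isOpen_one_lt_re.mem_nhds hs] with w hw
  rw [Pi.neg_apply, ArithmeticFunction.LSeries_vonMangoldt_eq_deriv_riemannZeta_div hw]
  ring

/-- Uniqueness of the derivative of `ζ' / ζ` links the von Mangoldt series, whose terms are visibly
nonnegative on the real axis, to the moments `ζ`, `-ζ'`, `ζ''` that occur in the Gaussian
computation. -/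
theorem zetaLogDerivDeriv_eq {s : ℂ} (hs : 1 < s.re) :
    zetaLogDerivDeriv s =
      LSeries (fun n : ℕ => ((Real.log n * (Real.log n * 1) : ℝ) : ℂ)) s / riemannZeta s -
        (LSeries (fun n : ℕ => ((Real.log n * 1 : ℝ) : ℂ)) s / riemannZeta s) ^ 2 := by
  have h0 := riemannZeta_ne_zero_of_one_lt_re hs
  have h := (hasDerivAt_deriv_riemannZeta hs).fun_div (hasDerivAt_riemannZeta hs) h0
  rw [(hasDerivAt_logDeriv_riemannZeta hs).unique h, (hasDerivAt_riemannZeta hs).deriv]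
  field_simp

theorem continuousOn_zetaLogDerivDeriv : ContinuousOn zetaLogDerivDeriv {s | 1 < s.re} :=
  fun _ hs => ((LSeries_hasDerivAt
    (abscissa_log_vonMangoldt_lt hs)).differentiableAt.continuousAt).continuousWithinAt

theorem ofReal_re_zetaLogDerivDeriv (x : ℝ) :
    ((zetaLogDerivDeriv x).re : ℂ) = zetaLogDerivDeriv x := by
  rw [zetaLogDerivDeriv, LSeries_ofReal_eq, Complex.ofReal_re]

/-- The density of zeros of the random Dirichlet series. -/
noncomputable def zeroDensity (z : ℂ) : ℝ :=
  Real.pi⁻¹ * (zetaLogDerivDeriv ((2 * z.re : ℝ) : ℂ)).re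

theorem hasSum_zetaLogDerivDeriv {x : ℝ} (hx : 1 < x) :
    HasSum (fun n : ℕ => if n = 0 then 0 else
      Real.log n * ArithmeticFunction.vonMangoldt n * (n : ℝ) ^ (-x)) (zetaLogDerivDeriv x).re :=
  hasSum_re_LSeries_ofReal (f := fun n : ℕ => Real.log n * ArithmeticFunction.vonMangoldt n)
    (LSeriesSummable_of_abscissaOfAbsConv_lt_re (abscissa_log_vonMangoldt_lt (by simpa using hx)))

theorem zetaLogDerivDeriv_term_nonneg (x : ℝ) (n : ℕ) : 0 ≤ (if n = 0 then 0 else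
    Real.log n * ArithmeticFunction.vonMangoldt n * (n : ℝ) ^ (-x)) := by
  split_ifs
  · exact le_rfl
  · exact mul_nonneg (mul_nonneg (Real.log_natCast_nonneg n)
      ArithmeticFunction.vonMangoldt_nonneg) (by positivity)

theorem two_mul_re_gt {z : ℂ} (hz : z ∈ halfPlane) : 1 < 2 * z.re := by
  have : 1 / 2 < z.re := hz
  linarith

theorem zeroDensity_nonneg {z : ℂ} (hz : z ∈ halfPlane) : 0 ≤ zeroDensity z := by
  refine mul_nonneg (by positivity) ?_
  exact (hasSum_zetaLogDerivDeriv (two_mul_re_gt hz)).nonneg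
    (zetaLogDerivDeriv_term_nonneg _)

theorem continuousOn_zeroDensity : ContinuousOn zeroDensity halfPlane := by
  refine continuousOn_const.mul (Complex.continuous_re.comp_continuousOn ?_)
  refine continuousOn_zetaLogDerivDeriv.comp (by fun_prop) fun z hz => ?_
  simpa using two_mul_re_gt hz

/-- The terms at primes are `log² p / p ≥ log² 2 / p`, and the sum of `1 / p` diverges. -/
theorem not_summable_log_mul_vonMangoldt_div : ¬ Summable (fun n : ℕ => if n = 0 then 0 else
    Real.log n * ArithmeticFunction.vonMangoldt n * (n : ℝ) ^ (-1 : ℝ)) := by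
  intro h
  refine not_summable_one_div_on_primes
    (Summable.of_nonneg_of_le (fun n => ?_) (fun n => ?_) (h.mul_left ((Real.log 2 ^ 2)⁻¹)))
  · exact Set.indicator_nonneg (fun _ _ => by positivity) n
  · by_cases hp : n.Prime
    · have hlog : 0 < Real.log 2 := Real.log_pos (by norm_num)
      have h2 : Real.log 2 ≤ Real.log n :=
        Real.log_le_log (by norm_num) (by exact_mod_cast hp.two_le)
      rw [Set.indicator_of_mem (show n ∈ {p | Nat.Prime p} from hp), if_neg hp.ne_zero,
        ArithmeticFunction.vonMangoldt_apply_prime hp, Real.rpow_neg_one, ← mul_assoc, one_div]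
      refine le_mul_of_one_le_left (by positivity) ?_
      rw [← div_eq_inv_mul, one_le_div (by positivity), sq]
      exact mul_le_mul h2 h2 hlog.le (hlog.le.trans h2)
    · rw [Set.indicator_of_notMem (show n ∉ {p | Nat.Prime p} from hp)]
      exact mul_nonneg (by positivity) (by
        simpa using zetaLogDerivDeriv_term_nonneg 1 n)

theorem tendsto_zeroDensity :
    Tendsto zeroDensity (comap Complex.re (𝓝[>] (1 / 2 : ℝ))) atTop := by
  -- The density depends only on the real part, whence uniformity in the imaginary part, which the
  -- `comap` filter encodes.
  suffices h : Tendsto (fun x : ℝ => Real.pi⁻¹ * (zetaLogDerivDeriv ((2 * x : ℝ) : ℂ)).re)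
      (𝓝[>] (1 / 2 : ℝ)) atTop from h.comp tendsto_comap
  refine Tendsto.const_mul_atTop (by positivity) ?_
  have hdiv := (not_summable_iff_tendsto_nat_atTop_of_nonneg
    (zetaLogDerivDeriv_term_nonneg 1)).1 not_summable_log_mul_vonMangoldt_div
  rw [tendsto_atTop]
  intro M
  -- A finite partial sum already exceeds `M` at the critical line; it is continuous in `x`, and by
  -- nonnegativity it bounds the full sum from below.
  obtain ⟨N, hN⟩ := (hdiv.eventually_gt_atTop M).exists
  have hc : Tendsto (fun x : ℝ => ∑ n ∈ Finset.range N, if n = 0 then 0 else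
      Real.log n * ArithmeticFunction.vonMangoldt n * (n : ℝ) ^ (-(2 * x))) (𝓝[>] (1 / 2 : ℝ))
      (𝓝 (∑ n ∈ Finset.range N, if n = 0 then 0 else
        Real.log n * ArithmeticFunction.vonMangoldt n * (n : ℝ) ^ (-1 : ℝ))) := by
    refine tendsto_finsetSum _ fun n _ => ?_
    split_ifs with hn
    · exact tendsto_const_nhds
    · refine Tendsto.const_mul _ ?_
      have hn' : (0 : ℝ) < n := by exact_mod_cast Nat.pos_of_ne_zero hn
      have hcont : Continuous fun x : ℝ => (n : ℝ) ^ (-(2 * x)) :=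
        continuous_const.rpow (by fun_prop) fun x => Or.inl hn'.ne'
      have := (hcont.tendsto (1 / 2)).mono_left (nhdsWithin_le_nhds (s := Set.Ioi (1 / 2)))
      simpa using this
  filter_upwards [hc.eventually_const_lt hN, self_mem_nhdsWithin] with x hx hx2
  have hx3 : 1 < 2 * x := by
    have : 1 / 2 < x := hx2
    linarith
  exact hx.le.trans (sum_le_hasSum _ (fun n _ => zetaLogDerivDeriv_term_nonneg _ n)
    (hasSum_zetaLogDerivDeriv hx3))

/-- The factor `1 / 2` comes from the argument `2 * x`; it turns the `1 / π` of the density into `1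
/ (2π)`. -/
theorem integral_zetaLogDerivDeriv {a b : ℝ} (ha : 1 / 2 < a) (hab : a ≤ b) :
    ((∫ x in a..b, (zetaLogDerivDeriv ((2 * x : ℝ) : ℂ)).re : ℝ) : ℂ) =
      1 / 2 * (deriv riemannZeta (2 * (b : ℂ)) / riemannZeta (2 * (b : ℂ)) -
        deriv riemannZeta (2 * (a : ℂ)) / riemannZeta (2 * (a : ℂ))) := by
  rw [← intervalIntegral.integral_ofReal]
  simp_rw [ofReal_re_zetaLogDerivDeriv]
  have hx : ∀ x ∈ Set.uIcc a b, 1 < ((2 * x : ℝ) : ℂ).re := fun x hx => by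
    rw [Set.uIcc_of_le hab] at hx
    rw [Complex.ofReal_re]
    linarith [hx.1]
  have hd : ∀ x ∈ Set.uIcc a b, HasDerivAt
      (fun x : ℝ => 1 / 2 * (deriv riemannZeta (2 * (x : ℂ)) / riemannZeta (2 * (x : ℂ))))
      (zetaLogDerivDeriv ((2 * x : ℝ) : ℂ)) x := by
    intro x hxm
    have h1 : HasDerivAt (fun x : ℝ => 2 * (x : ℂ)) 2 x := by
      simpa using (HasDerivAt.ofReal_comp (hasDerivAt_id x)).const_mul (2 : ℂ)
    have h2 : HasDerivAt (fun s => deriv riemannZeta s / riemannZeta s)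
        (zetaLogDerivDeriv (2 * (x : ℂ))) (2 * (x : ℂ)) :=
      hasDerivAt_logDeriv_riemannZeta (by simpa using hx x hxm)
    have h3 := (h2.comp x h1).const_mul (1 / 2 : ℂ)
    push_cast
    refine h3.congr_deriv ?_
    ring
  rw [intervalIntegral.integral_eq_sub_of_hasDerivAt hd]
  · ring
  · refine ContinuousOn.intervalIntegrable ?_
    exact continuousOn_zetaLogDerivDeriv.comp (by fun_prop) hx

/-! ### The Kac–Rice integrand at a point -/

theorem norm_sq_dirichletTerm (k : ℕ) (z : ℂ) :
    ‖dirichletTerm k z‖ ^ 2 = ((k : ℝ) + 2) ^ (-(2 * z.re)) := by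
  rw [norm_dirichletTerm, ← Real.rpow_natCast, ← Real.rpow_mul (by positivity)]
  congr 1
  push_cast
  ring

/-- The jointly measurable version of `tailSum`, vanishing off the sequences for which the series
is known to converge. -/
noncomputable def tailFun : (ℕ → ℂ) × ℂ → ℂ :=
  (temperedSeq ×ˢ halfPlane).indicator fun p => tailSum p.1 p.2

/-- The derivative of `tailFun` in its second variable. -/
noncomputable def tailDeriv : (ℕ → ℂ) × ℂ → ℂ :=
  (temperedSeq ×ˢ halfPlane).indicator fun p => deriv (tailSum p.1) p.2

theorem measurable_indicator_of_tendsto_sum {X : (ℕ → ℂ) × ℂ → ℂ} {d : ℕ → ℂ → ℂ}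
    (hd : ∀ k, Measurable (d k))
    (h : ∀ t ∈ temperedSeq, ∀ z ∈ halfPlane,
      Tendsto (fun n => ∑ k ∈ Finset.range n, t k * d k z) atTop (𝓝 (X (t, z)))) :
    Measurable ((temperedSeq ×ˢ halfPlane).indicator X) := by
  have hS : MeasurableSet (temperedSeq ×ˢ halfPlane) :=
    measurableSet_temperedSeq.prod isOpen_halfPlane.measurableSet
  refine measurable_of_tendsto_metrizable (f := fun n => (temperedSeq ×ˢ halfPlane).indicator
    fun p : (ℕ → ℂ) × ℂ => ∑ k ∈ Finset.range n, p.1 k * d k p.2) (fun n => ?_) ?_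
  · refine Measurable.indicator (Finset.measurable_sum _ fun k _ => ?_) hS
    exact ((measurable_pi_apply k).comp measurable_fst).mul ((hd k).comp measurable_snd)
  · rw [tendsto_pi_nhds]
    rintro ⟨t, z⟩
    by_cases hp : (t, z) ∈ temperedSeq ×ˢ halfPlane
    · simp only [Set.indicator_of_mem hp]
      exact h t hp.1 z hp.2
    · simp only [Set.indicator_of_notMem hp]
      exact tendsto_const_nhds

theorem measurable_dirichletTerm (k : ℕ) : Measurable (dirichletTerm k) :=
  (continuous_iff_continuousAt.2 fun z => (hasDerivAt_dirichletTerm k z).continuousAt).measurable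

theorem measurable_tailFun : Measurable tailFun :=
  measurable_indicator_of_tendsto_sum measurable_dirichletTerm fun _ ht _ hz =>
    tendsto_tailSum ht hz

theorem measurable_tailDeriv : Measurable tailDeriv :=
  measurable_indicator_of_tendsto_sum (fun k => (measurable_dirichletTerm k).const_mul _)
    fun _ ht _ hz => tendsto_deriv_tailSum ht hz

theorem tailFun_eq {t : ℕ → ℂ} (ht : t ∈ temperedSeq) {z : ℂ} (hz : z ∈ halfPlane) :
    tailFun (t, z) = tailSum t z :=
  Set.indicator_of_mem (Set.mk_mem_prod ht hz) _

theorem tailDeriv_eq {t : ℕ → ℂ} (ht : t ∈ temperedSeq) {z : ℂ} (hz : z ∈ halfPlane) :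
    tailDeriv (t, z) = deriv (tailSum t) z :=
  Set.indicator_of_mem (Set.mk_mem_prod ht hz) _

theorem hasDerivAt_tailFun (t : ℕ → ℂ) {z : ℂ} (hz : z ∈ halfPlane) :
    HasDerivAt (fun z => tailFun (t, z)) (tailDeriv (t, z)) z := by
  by_cases ht : t ∈ temperedSeq
  · rw [tailDeriv_eq ht hz]
    refine (hasDerivAt_tailSum ht hz).congr_of_eventuallyEq ?_
    filter_upwards [isOpen_halfPlane.mem_nhds hz] with w hw using tailFun_eq ht hw
  · have h1 : (fun z => tailFun (t, z)) = fun _ => 0 := by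
      ext w; exact Set.indicator_of_notMem (fun h => ht h.1) _
    have h2 : tailDeriv (t, z) = 0 := Set.indicator_of_notMem (fun h => ht h.1) _
    rw [h1, h2]
    exact hasDerivAt_const z 0

/-- The Kac–Rice integrand at `z` integrates to the density of zeros. -/
theorem lintegral_complexNormalPDF_tailFun {v : ℝ≥0} (hv : v ≠ 0) {z : ℂ} (hz : z ∈ halfPlane) :
    ∫⁻ t, ENNReal.ofReal (complexNormalPDF v (tailFun (t, z))) *
        ENNReal.ofReal (‖tailDeriv (t, z)‖ ^ 2) ∂normalSeq v =
      ENNReal.ofReal (zeroDensity z) := by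
  have hs : 1 < ((2 * z.re : ℝ) : ℂ).re := two_mul_re_gt hz
  set s : ℝ := 2 * z.re with hsdef
  set E : ℕ → ℝ := fun k => ((k : ℝ) + 2) ^ (-s) with hE
  set ℓ : ℕ → ℝ := fun k => Real.log ((k : ℝ) + 2) with hℓ
  -- The values `Z`, `B`, `C` are `ζ`, `-ζ'`, `ζ''` at `s`, realized as real numbers.
  obtain ⟨Z, hZ⟩ : ∃ Z : ℝ, riemannZeta s = Z := ⟨_, by
    rw [riemannZeta_eq_LSeries hs, LSeries_ofReal_eq (fun _ => 1)]⟩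
  obtain ⟨B, hB⟩ : ∃ B : ℝ, LSeries (fun n : ℕ => ((Real.log n * 1 : ℝ) : ℂ)) s = B :=
    ⟨_, LSeries_ofReal_eq (fun n : ℕ => Real.log n * 1) s⟩
  obtain ⟨C, hC⟩ : ∃ C : ℝ,
      LSeries (fun n : ℕ => ((Real.log n * (Real.log n * 1) : ℝ) : ℂ)) s = C :=
    ⟨_, LSeries_ofReal_eq (fun n : ℕ => Real.log n * (Real.log n * 1)) s⟩
  have hsumA : HasSum E (Z - 1) := by
    have := hasSum_re_LSeries_ofReal_add_two (f := fun _ => 1) (x := s)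
      (LSeriesSummable_of_abscissaOfAbsConv_lt_re (abscissa_one_lt hs))
    rw [← riemannZeta_eq_LSeries hs, hZ, Complex.ofReal_re] at this
    simpa using this
  have hsumB : HasSum (fun k => ℓ k * E k) B := by
    have := hasSum_re_LSeries_ofReal_add_two (f := fun n : ℕ => Real.log n * 1) (x := s)
      (LSeriesSummable_of_abscissaOfAbsConv_lt_re (abscissa_log_lt hs))
    rw [hB, Complex.ofReal_re] at this
    simpa using this
  have hsumC : HasSum (fun k => ℓ k ^ 2 * E k) C := by
    have := hasSum_re_LSeries_ofReal_add_two (f := fun n : ℕ => Real.log n * (Real.log n * 1))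
      (x := s) (LSeriesSummable_of_abscissaOfAbsConv_lt_re (abscissa_log_sq_lt hs))
    rw [hC, Complex.ofReal_re] at this
    simpa [sq] using this
  have hE0 : ∀ k, 0 < E k := fun k => by simp only [hE]; positivity
  have hApos : 0 < Z - 1 := by
    refine lt_of_lt_of_le (hE0 0) ?_
    exact le_hasSum hsumA 0 fun k _ => (hE0 k).le
  obtain ⟨A, hA⟩ : ∃ A : ℝ≥0, (A : ℝ) = Z - 1 := ⟨⟨Z - 1, hApos.le⟩, rfl⟩
  have hA0 : A ≠ 0 := by
    rintro rfl
    simp only [NNReal.coe_zero] at hA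
    linarith
  rw [← hA] at hsumA
  have hZA : Z = 1 + A := by rw [hA]; ring
  have hApos' : (0 : ℝ) < A := hA ▸ hApos
  -- The regression coefficient of the derivative on the tail: `-B` and `A` are, up to a common
  -- factor, their covariance and the variance of the tail. The residual variance is then `C - B ^ 2
  -- / A`.
  set β : ℝ := -B / A with hβ
  have hsumD : HasSum (fun k => (ℓ k + β) ^ 2 * E k) (C - B ^ 2 / A) := by
    have h := (hsumC.add (hsumB.mul_left (2 * β))).add (hsumA.mul_left (β ^ 2))
    have he : C + 2 * β * B + β ^ 2 * A = C - B ^ 2 / A := by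
      rw [hβ]; field_simp; ring
    rw [he] at h
    have hf : (fun k => (ℓ k + β) ^ 2 * E k) = fun k =>
        ℓ k ^ 2 * E k + 2 * β * (ℓ k * E k) + β ^ 2 * E k := by
      funext k; ring
    rw [hf]
    exact h
  have hDnn : 0 ≤ C - B ^ 2 / A :=
    hsumD.nonneg fun k => mul_nonneg (sq_nonneg _) (hE0 k).le
  obtain ⟨D, hD⟩ : ∃ D : ℝ≥0, (D : ℝ) = C - B ^ 2 / A := ⟨⟨_, hDnn⟩, rfl⟩
  rw [← hD] at hsumD
  have hsumO : HasSum (fun k => (ℓ k + β) * E k) 0 := by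
    have h := hsumB.add (hsumA.mul_left β)
    have he : B + β * A = 0 := by rw [hβ]; field_simp; ring
    rw [he] at h
    have hf : (fun k => (ℓ k + β) * E k) = fun k => ℓ k * E k + β * E k := by
      funext k; ring
    rw [hf]
    exact h
  set b : ℕ → ℂ := fun k => dirichletTerm k z with hb
  set c : ℕ → ℂ := fun k => -((ℓ k + β : ℝ) : ℂ) * dirichletTerm k z with hc
  have hbs : HasSum (fun k => ‖b k‖ ^ 2) (A : ℝ) := by
    simpa only [hb, norm_sq_dirichletTerm] using hsumA
  have hcs : HasSum (fun k => ‖c k‖ ^ 2) (D : ℝ) := by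
    have : (fun k => ‖c k‖ ^ 2) = fun k => (ℓ k + β) ^ 2 * E k := by
      funext k
      rw [hc, norm_mul, mul_pow, norm_sq_dirichletTerm, norm_neg, Complex.norm_real,
        Real.norm_eq_abs, sq_abs]
    rw [this]
    exact hsumD
  have hbc : HasSum (fun k => b k * (starRingEnd ℂ) (c k)) 0 := by
    have : (fun k => b k * (starRingEnd ℂ) (c k)) =
        fun k => ((-((ℓ k + β) * E k) : ℝ) : ℂ) := by
      funext k
      simp only [hb, hc]
      rw [map_mul, map_neg, Complex.conj_ofReal, mul_left_comm, Complex.mul_conj,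
        Complex.normSq_eq_norm_sq, norm_sq_dirichletTerm]
      push_cast
      ring
    rw [this]
    have h := Complex.hasSum_ofReal.2 hsumO.neg
    simpa using h
  set X : (ℕ → ℂ) → ℂ := fun t => tailFun (t, z)
  set Y : (ℕ → ℂ) → ℂ := fun t => tailDeriv (t, z) - β * tailFun (t, z)
  have hX : Measurable X := measurable_tailFun.comp (by fun_prop)
  have hX' : Measurable fun t => tailDeriv (t, z) := measurable_tailDeriv.comp (by fun_prop)
  have hY : Measurable Y := hX'.sub (hX.const_mul _)
  have hlaw := map_prod_eq_prod_complexNormal (v := v) hbs hcs hbc hX hY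
    (by
      filter_upwards [ae_mem_temperedSeq hv] with t ht
      simpa only [X, tailFun_eq ht hz] using tendsto_tailSum ht hz)
    (by
      filter_upwards [ae_mem_temperedSeq hv] with t ht
      simp only [Y, tailFun_eq ht hz, tailDeriv_eq ht hz]
      refine ((tendsto_deriv_tailSum ht hz).sub
        ((tendsto_tailSum ht hz).const_mul (β : ℂ))).congr fun n => ?_
      rw [Finset.mul_sum, ← Finset.sum_sub_distrib]
      refine Finset.sum_congr rfl fun k _ => ?_
      simp only [hc, hℓ]
      push_cast
      ring)
  have hn : Measurable fun p : ℂ × ℂ => ENNReal.ofReal (‖(β : ℂ) * p.1 + p.2‖ ^ 2) :=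
    ((((measurable_fst.const_mul (β : ℂ)).add measurable_snd).norm).pow_const 2).ennreal_ofReal
  have hm : Measurable fun p : ℂ × ℂ => ENNReal.ofReal (complexNormalPDF v p.1) :=
    (measurable_complexNormalPDF v).ennreal_ofReal.comp measurable_fst
  have hmn : Measurable fun p : ℂ × ℂ => ENNReal.ofReal (complexNormalPDF v p.1) *
      ENNReal.ofReal (‖(β : ℂ) * p.1 + p.2‖ ^ 2) := hm.mul hn
  have hint := lintegral_map (μ := normalSeq v) hmn (hX.prodMk hY)
  rw [hlaw, lintegral_complexNormalPDF_mul_norm_sq hv (mul_ne_zero hv hA0)] at hint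
  have hxy : ∀ t, (β : ℂ) * X t + Y t = tailDeriv (t, z) := fun t => by
    simp only [X, Y]; ring
  simp only [hxy] at hint
  rw [← hint]
  congr 1
  rw [zeroDensity, ← hsdef, zetaLogDerivDeriv_eq hs, hZ, hB, hC, hZA]
  have hre : ((C : ℂ) / ((1 + A : ℝ) : ℂ) - ((B : ℂ) / ((1 + A : ℝ) : ℂ)) ^ 2).re =
      C / (1 + A) - (B / (1 + A)) ^ 2 := by
    rw [← Complex.ofReal_div, ← Complex.ofReal_div, ← Complex.ofReal_pow, ← Complex.ofReal_sub,
      Complex.ofReal_re]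
  have hv0 : (0 : ℝ) < v := by exact_mod_cast pos_iff_ne_zero.2 hv
  have hC' : C = D + B ^ 2 / A := by rw [hD]; ring
  rw [hre, Complex.norm_real, Real.norm_eq_abs, sq_abs, hβ, hC']
  -- What remains is `(B² / (A ζ) + C - B² / A) / ζ = C / ζ - (B / ζ)²` with `ζ = 1 + A`; the
  -- variance `v` cancels.
  push_cast
  field_simp
  ring

/-! ### The Kac–Rice formula for the random series -/

theorem complexNormal_eq_withDensity {v : ℝ≥0} (hv : v ≠ 0) :
    complexNormal v = volume.withDensity fun w => ENNReal.ofReal (complexNormalPDF v w) := by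
  refine Measure.ext_of_lintegral _ fun φ hφ => ?_
  rw [lintegral_complexNormal hv hφ, lintegral_withDensity_eq_lintegral_mul _
    (measurable_complexNormalPDF v).ennreal_ofReal hφ]
  rfl

/-- The Kac–Rice formula for a holomorphic function shifted by a complex normal variable. -/
theorem lintegral_zeroCount_const_add {v : ℝ≥0} (hv : v ≠ 0) {U : Set ℂ} (hU : IsOpen U)
    {g g' : ℂ → ℂ} (hg : ∀ z ∈ U, HasDerivAt g (g' z) z) {B : Set ℂ} (hB : MeasurableSet B)
    (hBU : B ⊆ U) :
    ∫⁻ a, zeroCount (fun z => a + g z) B ∂complexNormal v =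
      ∫⁻ z in B, ENNReal.ofReal (complexNormalPDF v (g z)) * ENNReal.ofReal (‖g' z‖ ^ 2) := by
  have hm := (measurable_complexNormalPDF v).ennreal_ofReal
  -- Finiteness of the density replaces measurability of the count in `a`. Reflection, under which
  -- the density is invariant, turns zeros of `a + g` into the fibre of `g` over `w`.
  rw [complexNormal_eq_withDensity hv, lintegral_withDensity_eq_lintegral_mul_non_measurable _ hm
    (Eventually.of_forall fun _ => ENNReal.ofReal_lt_top), ← lintegral_neg_eq_self]
  simp_rw [mul_comm (ENNReal.ofReal (complexNormalPDF v (g _)))]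
  rw [← lintegral_encard_fiber_mul hU hg hB hBU hm]
  refine lintegral_congr fun w => ?_
  simp only [Pi.mul_apply, complexNormalPDF_neg, zeroCount, neg_add_eq_zero]
  rw [mul_comm]
  simp only [eq_comm]

/-- The random Dirichlet series as a function of its first coefficient and the remaining ones. -/
noncomputable def shiftedSeries (p : ℂ × (ℕ → ℂ)) (z : ℂ) : ℂ := p.1 + tailFun (p.2, z)

theorem lintegral_zeroCount_shiftedSeries {v : ℝ≥0} (hv : v ≠ 0) {B : Set ℂ}
    (hB : MeasurableSet B) (hBU : B ⊆ halfPlane)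
    (hm : AEMeasurable (fun p => zeroCount (shiftedSeries p) B)
      ((complexNormal v).prod (normalSeq v))) :
    ∫⁻ p, zeroCount (shiftedSeries p) B ∂(complexNormal v).prod (normalSeq v) =
      ∫⁻ z in B, ENNReal.ofReal (zeroDensity z) := by
  rw [lintegral_prod_symm _ hm]
  have hinner : ∀ t, ∫⁻ a, zeroCount (shiftedSeries (a, t)) B ∂complexNormal v =
      ∫⁻ z in B, ENNReal.ofReal (complexNormalPDF v (tailFun (t, z))) *
        ENNReal.ofReal (‖tailDeriv (t, z)‖ ^ 2) := fun t =>
    lintegral_zeroCount_const_add hv isOpen_halfPlane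
      (fun z hz => hasDerivAt_tailFun t hz) hB hBU
  simp_rw [hinner]
  have hmeas : Measurable fun p : (ℕ → ℂ) × ℂ => ENNReal.ofReal (complexNormalPDF v (tailFun p)) *
      ENNReal.ofReal (‖tailDeriv p‖ ^ 2) :=
    ((measurable_complexNormalPDF v).comp measurable_tailFun).ennreal_ofReal.mul
      (measurable_tailDeriv.norm.pow_const 2).ennreal_ofReal
  rw [lintegral_lintegral_swap (f := fun t z => ENNReal.ofReal (complexNormalPDF v (tailFun (t, z)))
    * ENNReal.ofReal (‖tailDeriv (t, z)‖ ^ 2)) hmeas.aemeasurable]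
  exact setLIntegral_congr_fun hB fun z hz => lintegral_complexNormalPDF_tailFun hv (hBU hz)

theorem continuousOn_shiftedSeries (p : ℂ × (ℕ → ℂ)) : ContinuousOn (shiftedSeries p) halfPlane :=
  fun _ hz => (continuousAt_const.add (hasDerivAt_tailFun p.2 hz).continuousAt).continuousWithinAt

theorem measurable_shiftedSeries (z : ℂ) : Measurable fun p => shiftedSeries p z :=
  measurable_fst.add (measurable_tailFun.comp (measurable_snd.prodMk measurable_const))

theorem lintegral_zeroDensity_lt_top {K : Set ℂ} (hK : IsCompact K) (hKU : K ⊆ halfPlane) :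
    ∫⁻ z in K, ENNReal.ofReal (zeroDensity z) < ∞ :=
  ((continuousOn_zeroDensity.mono hKU).integrableOn_compact hK).lintegral_lt_top

/-- On compact sets the count is measurable with no finiteness assumption, so the expectation
formula applies there and is finite. This supplies the finiteness required for general Borel sets
without circularity. -/
theorem ae_zeroCount_ne_top {v : ℝ≥0} (hv : v ≠ 0) {K : Set ℂ} (hK : IsCompact K)
    (hKU : K ⊆ halfPlane) :
    ∀ᵐ p ∂(complexNormal v).prod (normalSeq v), zeroCount (shiftedSeries p) K ≠ ∞ := by
  have hm := measurable_zeroCount_of_isCompact hK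
    (fun p => (continuousOn_shiftedSeries p).mono hKU) (fun z _ => measurable_shiftedSeries z)
  have h := (lintegral_zeroCount_shiftedSeries hv hK.measurableSet hKU hm.aemeasurable).trans_lt
    (lintegral_zeroDensity_lt_top hK hKU)
  filter_upwards [ae_lt_top hm h.ne] with p hp using hp.ne

theorem exists_compact_exhaustion_halfPlane :
    ∃ K : ℕ → Set ℂ, (∀ n, IsCompact (K n)) ∧ Monotone K ∧ ⋃ n, K n = halfPlane := by
  refine ⟨fun n => Metric.closedBall 0 n ∩ {z | 1 / 2 + 1 / ((n : ℝ) + 1) ≤ z.re},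
    fun n => (isCompact_closedBall _ _).inter_right
      (isClosed_le continuous_const Complex.continuous_re), fun m n hmn z hz => ⟨?_, ?_⟩, ?_⟩
  · exact Metric.closedBall_subset_closedBall (by exact_mod_cast hmn) hz.1
  · have h1 : 1 / 2 + 1 / ((m : ℝ) + 1) ≤ z.re := hz.2
    have h2 : 1 / ((n : ℝ) + 1) ≤ 1 / ((m : ℝ) + 1) :=
      one_div_le_one_div_of_le (by positivity) (by exact_mod_cast Nat.succ_le_succ hmn)
    exact (add_le_add_right h2 _).trans h1
  · ext z
    simp only [Set.mem_iUnion, Set.mem_inter_iff, Metric.mem_closedBall, dist_zero_right,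
      Set.mem_ofPred_eq]
    constructor
    · rintro ⟨n, -, h⟩
      have : (0 : ℝ) < 1 / ((n : ℝ) + 1) := by positivity
      linarith
    · intro h
      have h1 : ∀ᶠ n : ℕ in atTop, ‖z‖ ≤ n := tendsto_natCast_atTop_atTop.eventually_ge_atTop _
      have h2 : ∀ᶠ n : ℕ in atTop, 1 / ((n : ℝ) + 1) < z.re - 1 / 2 :=
        tendsto_one_div_add_atTop_nhds_zero_nat.eventually_lt_const (by linarith)
      obtain ⟨n, hn1, hn2⟩ := (h1.and h2).exists
      exact ⟨n, hn1, by linarith⟩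

theorem aemeasurable_zeroCount_shiftedSeries {v : ℝ≥0} (hv : v ≠ 0) {B : Set ℂ}
    (hB : MeasurableSet B) (hBU : B ⊆ halfPlane) :
    AEMeasurable (fun p => zeroCount (shiftedSeries p) B)
      ((complexNormal v).prod (normalSeq v)) := by
  obtain ⟨K, hK, hmono, hKU⟩ := exists_compact_exhaustion_halfPlane
  have hsub : ∀ n, K n ⊆ halfPlane := fun n => hKU ▸ Set.subset_iUnion K n
  exact aemeasurable_zeroCount hK hmono (fun p n => (continuousOn_shiftedSeries p).mono (hsub n))
    (fun n z _ => measurable_shiftedSeries z) (fun n => ae_zeroCount_ne_top hv (hK n) (hsub n)) hB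
    (hKU ▸ hBU)

/-! ### Splitting off the first coefficient, rectangles, and transfer to Ω -/

/-- Splitting the first term off a sequence of independent variables. -/
theorem map_head_tail_normalSeq (v : ℝ≥0) :
    (normalSeq v).map (fun c => (c 0, fun k => c (k + 1))) =
      (complexNormal v).prod (normalSeq v) := by
  let cons : ℂ × (ℕ → ℂ) → ℕ → ℂ := fun p k => Nat.casesOn k p.1 p.2
  have hcons : Measurable cons := by
    refine measurable_pi_iff.2 fun k => ?_
    cases k with
    | zero => exact measurable_fst
    | succ k => exact (measurable_pi_apply k).comp measurable_snd
  have hsplit : Measurable fun c : ℕ → ℂ => (c 0, fun k => c (k + 1)) :=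
    (measurable_pi_apply 0).prodMk (measurable_pi_iff.2 fun k => measurable_pi_apply (k + 1))
  -- It is easier to push forward along the inverse map: an infinite product measure is determined
  -- by its values on finite-dimensional boxes.
  have hmap : ((complexNormal v).prod (normalSeq v)).map cons = normalSeq v := by
    refine Measure.eq_infinitePi _ fun s t ht => ?_
    rw [Measure.map_apply hcons (MeasurableSet.pi s.countable_toSet fun i _ => ht i)]
    let s' : Finset ℕ := s.preimage (· + 1) (fun a _ b _ h => by simpa using h)
    have hpre : cons ⁻¹' (Set.pi s t) =
        (if 0 ∈ s then t 0 else Set.univ) ×ˢ Set.pi s' (fun k => t (k + 1)) := by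
      ext p
      simp only [Set.mem_preimage, Set.mem_pi, Set.mem_prod, Finset.mem_coe, s']
      constructor
      · intro h
        refine ⟨?_, fun k hk => h (k + 1) (Finset.mem_preimage (f := (· + 1)).1 hk)⟩
        split_ifs with h0
        · exact h 0 h0
        · trivial
      · rintro ⟨h0, h⟩ k hk
        cases k with
        | zero => rwa [if_pos hk] at h0
        | succ k => exact h k (Finset.mem_preimage.2 hk)
    have hprod : ∏ k ∈ s', complexNormal v (t (k + 1)) =
        ∏ i ∈ s, if i = 0 then 1 else complexNormal v (t i) := by
      rw [← Finset.prod_preimage (· + 1) s (fun a _ b _ h => by simpa using h)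
        (fun i => if i = 0 then 1 else complexNormal v (t i))]
      · exact Finset.prod_congr rfl fun k _ => by simp
      · intro i _ hi
        cases i with
        | zero => simp
        | succ i => exact (hi ⟨i, rfl⟩).elim
    rw [hpre, Measure.prod_prod, Measure.infinitePi_pi _ (fun k _ => ht (k + 1)), hprod]
    by_cases h0 : 0 ∈ s
    · rw [if_pos h0, ← Finset.mul_prod_erase s _ h0, ← Finset.mul_prod_erase s
        (fun i => complexNormal v (t i)) h0, if_pos rfl, one_mul]
      congr 1
      exact Finset.prod_congr rfl fun i hi => if_neg (Finset.ne_of_mem_erase hi)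
    · rw [if_neg h0, measure_univ, one_mul]
      exact Finset.prod_congr rfl fun i hi => if_neg (by rintro rfl; exact h0 hi)
  rw [← hmap, Measure.map_map hsplit hcons]
  have : (fun c : ℕ → ℂ => (c 0, fun k => c (k + 1))) ∘ cons = id := rfl
  rw [this, Measure.map_id, hmap]

/-- The density depends only on the real part, so Tonelli leaves the height as a factor. -/
theorem lintegral_zeroDensity_rectangle {x₁ x₂ y₁ y₂ : ℝ} (hx₁ : 1 / 2 < x₁) (hx : x₁ < x₂)
    (hy : y₁ < y₂) :
    ∫⁻ z in {z : ℂ | x₁ < z.re ∧ z.re < x₂ ∧ y₁ < z.im ∧ z.im < y₂},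
        ENNReal.ofReal (zeroDensity z) =
      ENNReal.ofReal (Real.pi⁻¹ *
        (∫ x in x₁..x₂, (zetaLogDerivDeriv ((2 * x : ℝ) : ℂ)).re) * (y₂ - y₁)) := by
  set h : ℝ → ℝ := fun x => (zetaLogDerivDeriv ((2 * x : ℝ) : ℂ)).re with hh
  have hcont : ContinuousOn h (Set.Icc x₁ x₂) := by
    refine Complex.continuous_re.comp_continuousOn ?_
    refine continuousOn_zetaLogDerivDeriv.comp (by fun_prop) fun x hxm => ?_
    have := hxm.1
    simp only [Set.mem_ofPred_eq, Complex.ofReal_re]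
    linarith
  have hset : {z : ℂ | x₁ < z.re ∧ z.re < x₂ ∧ y₁ < z.im ∧ z.im < y₂} =
      Complex.measurableEquivRealProd ⁻¹' (Set.Ioo x₁ x₂ ×ˢ Set.Ioo y₁ y₂) := by
    ext z
    simp [and_assoc]
  have hint : IntegrableOn h (Set.Ioo x₁ x₂) :=
    (hcont.integrableOn_compact isCompact_Icc).mono_set Set.Ioo_subset_Icc_self
  have hnn : ∀ x ∈ Set.Ioo x₁ x₂, 0 ≤ h x := by
    intro x hxm
    have h1 := zeroDensity_nonneg (z := (x : ℂ)) (by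
      have := hxm.1
      simp only [Set.mem_ofPred_eq, Complex.ofReal_re]
      linarith)
    rw [zeroDensity, Complex.ofReal_re] at h1
    exact nonneg_of_mul_nonneg_right h1 (by positivity)
  have hz : ∀ z : ℂ, ENNReal.ofReal (zeroDensity z) =
      ENNReal.ofReal (Real.pi⁻¹ * h (Complex.measurableEquivRealProd z).1) := fun z => rfl
  simp_rw [hz]
  rw [hset, Complex.volume_preserving_equiv_real_prod.setLIntegral_comp_preimage_emb
    (MeasurableEquiv.measurableEmbedding _)
    (fun p : ℝ × ℝ => ENNReal.ofReal (Real.pi⁻¹ * h p.1)), Measure.volume_eq_prod,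
    ← Measure.prod_restrict]
  have haem : AEMeasurable (fun x => ENNReal.ofReal (Real.pi⁻¹ * h x))
      (volume.restrict (Set.Ioo x₁ x₂)) := (hint.aemeasurable.const_mul _).ennreal_ofReal
  have haem' : AEMeasurable (fun p : ℝ × ℝ => ENNReal.ofReal (Real.pi⁻¹ * h p.1))
      ((volume.restrict (Set.Ioo x₁ x₂)).prod (volume.restrict (Set.Ioo y₁ y₂))) :=
    haem.comp_quasiMeasurePreserving Measure.quasiMeasurePreserving_fst
  rw [lintegral_prod_symm _ haem']
  simp only [lintegral_const, Measure.restrict_apply_univ, Real.volume_Ioo]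
  rw [← ofReal_integral_eq_lintegral_ofReal (hint.const_mul _)
    ((ae_restrict_iff' measurableSet_Ioo).2 (Eventually.of_forall fun x hxm =>
      mul_nonneg (by positivity) (hnn x hxm))), integral_const_mul,
    ← ENNReal.ofReal_mul' (by linarith), intervalIntegral.integral_of_le hx.le,
    integral_Ioc_eq_integral_Ioo]

/-- Only the tempered event is transferred through the law; on it the identity holds at all `z`
simultaneously. -/
theorem ae_eq_shiftedSeries {Ω : Type*} [MeasurableSpace Ω] {P : Measure Ω}
    {v : ℝ≥0} {a : ℕ → Ω → ℂ} (hv : v ≠ 0)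
    (h : AEMeasurable (fun ω => ((a 0 ω, fun k => a (k + 1) ω) : ℂ × (ℕ → ℂ))) P)
    (hΦ : P.map (fun ω => ((a 0 ω, fun k => a (k + 1) ω) : ℂ × (ℕ → ℂ))) =
      (complexNormal v).prod (normalSeq v)) :
    ∀ᵐ ω ∂P, (fun k => a (k + 1) ω) ∈ temperedSeq ∧ ∀ z ∈ halfPlane,
      dirichletSum (fun k => a k ω) z = shiftedSeries (a 0 ω, fun k => a (k + 1) ω) z := by
  have h1 : ∀ᵐ p ∂(complexNormal v).prod (normalSeq v), p.2 ∈ temperedSeq :=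
    Measure.quasiMeasurePreserving_snd.ae (ae_mem_temperedSeq hv)
  rw [← hΦ] at h1
  filter_upwards [ae_of_ae_map h h1] with ω hω
  refine ⟨hω, fun z hz => ?_⟩
  rw [dirichletSum_eq hω hz, shiftedSeries, tailFun_eq hω hz]

theorem zeroCount_congr {f g : ℂ → ℂ} {B : Set ℂ} (h : ∀ z ∈ B, f z = g z) :
    zeroCount f B = zeroCount g B := by
  have : {z | z ∈ B ∧ f z = 0} = {z | z ∈ B ∧ g z = 0} := by
    ext z
    exact and_congr_right fun hz => by rw [h z hz]
  rw [zeroCount, zeroCount, this]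

end RandomDirichlet

/-! ### The main theorem -/

open RandomDirichlet in
theorem theorem8p3 {Ω : Type*} [MeasurableSpace Ω] (P : Measure Ω) [IsProbabilityMeasure P]
    (v : ℝ≥0) (hv : v ≠ 0) (a : ℕ → Ω → ℂ) (hindep : iIndepFun a P)
    (hlaw : ∀ k, HasLaw (a k) (RandomDirichlet.complexNormal v) P) :
    -- almost surely, the series converges at every point of the half-plane
    (∀ᵐ ω ∂P, ∀ z : ℂ, 1 / 2 < z.re →
      Tendsto (fun n => RandomDirichlet.partialSum (fun k => a k ω) n z) atTop
        (𝓝 (RandomDirichlet.dirichletSum (fun k => a k ω) z))) ∧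
    -- the number of zeros in a Borel subset of the half-plane is a random variable
    (∀ B : Set ℂ, MeasurableSet B → B ⊆ {z : ℂ | 1 / 2 < z.re} →
      AEMeasurable (fun ω =>
        RandomDirichlet.zeroCount (RandomDirichlet.dirichletSum (fun k => a k ω)) B) P) ∧
    -- the expected number of zeros in a rectangle is finite, with the stated value
    (∀ x₁ x₂ y₁ y₂ : ℝ, 1 / 2 < x₁ → x₁ < x₂ → y₁ < y₂ →
      RandomDirichlet.expectedZeros P
          (fun ω => RandomDirichlet.dirichletSum (fun k => a k ω))
          {z : ℂ | x₁ < z.re ∧ z.re < x₂ ∧ y₁ < z.im ∧ z.im < y₂} ≠ ∞ ∧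
      ((RandomDirichlet.expectedZeros P
          (fun ω => RandomDirichlet.dirichletSum (fun k => a k ω))
          {z : ℂ | x₁ < z.re ∧ z.re < x₂ ∧ y₁ < z.im ∧ z.im < y₂}).toReal : ℂ) =
        1 / (2 * (Real.pi : ℂ)) *
          (deriv riemannZeta (2 * (x₂ : ℂ)) / riemannZeta (2 * (x₂ : ℂ)) -
            deriv riemannZeta (2 * (x₁ : ℂ)) / riemannZeta (2 * (x₁ : ℂ))) *
          ((y₂ : ℂ) - (y₁ : ℂ))) ∧
    -- the density of zeros exists and tends to infinity as `Re z` decreases to `1 / 2`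
    (∃ ρ : ℂ → ℝ,
      RandomDirichlet.IsZeroDensity P
        (fun ω => RandomDirichlet.dirichletSum (fun k => a k ω))
        {z : ℂ | 1 / 2 < z.re} ρ ∧
      Tendsto ρ (comap Complex.re (𝓝[>] (1 / 2 : ℝ))) atTop) := by
  have hseq : AEMeasurable (fun ω k => a k ω) P :=
    aemeasurable_pi_iff.2 fun k => (hlaw k).aemeasurable
  have hsplit : Measurable fun c : ℕ → ℂ => (c 0, fun k => c (k + 1)) :=
    (measurable_pi_apply 0).prodMk (measurable_pi_iff.2 fun k => measurable_pi_apply (k + 1))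
  have hΦm : AEMeasurable (fun ω => ((a 0 ω, fun k => a (k + 1) ω) : ℂ × (ℕ → ℂ))) P :=
    hsplit.comp_aemeasurable hseq
  have hΦ : P.map (fun ω => ((a 0 ω, fun k => a (k + 1) ω) : ℂ × (ℕ → ℂ))) =
      (complexNormal v).prod (normalSeq v) := by
    -- Independence and the common law determine the joint law, so everything can be computed on the
    -- product space.
    have hl : P.map (fun ω k => a k ω) = normalSeq v :=
      (hindep.hasLaw_infinitePi hlaw hseq).map_eq
    rw [← map_head_tail_normalSeq, ← hl,
      AEMeasurable.map_map_of_aemeasurable hsplit.aemeasurable hseq]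
    rfl
  have hae := ae_eq_shiftedSeries hv hΦm hΦ
  have hcount : ∀ B : Set ℂ, B ⊆ halfPlane →
      (fun ω => zeroCount (dirichletSum (fun k => a k ω)) B) =ᵐ[P]
        fun ω => zeroCount (shiftedSeries (a 0 ω, fun k => a (k + 1) ω)) B := by
    intro B hBU
    filter_upwards [hae] with ω hω
    exact zeroCount_congr fun z hz => hω.2 z (hBU hz)
  have hmeas : ∀ B : Set ℂ, MeasurableSet B → B ⊆ halfPlane →
      AEMeasurable (fun p => zeroCount (shiftedSeries p) B)
        (P.map (fun ω => ((a 0 ω, fun k => a (k + 1) ω) : ℂ × (ℕ → ℂ)))) := by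
    intro B hB hBU
    rw [hΦ]
    exact aemeasurable_zeroCount_shiftedSeries hv hB hBU
  have hexp : ∀ B : Set ℂ, MeasurableSet B → B ⊆ halfPlane →
      expectedZeros P (fun ω => dirichletSum (fun k => a k ω)) B =
        ∫⁻ z in B, ENNReal.ofReal (zeroDensity z) := by
    intro B hB hBU
    rw [expectedZeros, lintegral_congr_ae (hcount B hBU),
      ← lintegral_map' (hmeas B hB hBU) hΦm, hΦ]
    exact lintegral_zeroCount_shiftedSeries hv hB hBU
      (aemeasurable_zeroCount_shiftedSeries hv hB hBU)
  refine ⟨?_, fun B hB hBU => ?_, fun x₁ x₂ y₁ y₂ hx₁ hx hy => ?_, zeroDensity, ⟨?_, ?_, ?_⟩, ?_⟩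
  · filter_upwards [hae] with ω hω z hz
    rw [dirichletSum_eq hω.1 hz]
    exact tendsto_partialSum hω.1 hz
  · exact ((hmeas B hB hBU).comp_aemeasurable hΦm).congr (hcount B hBU).symm
  · have hRm : MeasurableSet {z : ℂ | x₁ < z.re ∧ z.re < x₂ ∧ y₁ < z.im ∧ z.im < y₂} :=
      (measurableSet_lt measurable_const Complex.measurable_re).inter
        ((measurableSet_lt Complex.measurable_re measurable_const).inter
          ((measurableSet_lt measurable_const Complex.measurable_im).inter
            (measurableSet_lt Complex.measurable_im measurable_const)))
    have hnn : 0 ≤ ∫ x in x₁..x₂, (zetaLogDerivDeriv ((2 * x : ℝ) : ℂ)).re := by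
      refine intervalIntegral.integral_nonneg hx.le fun x hxm => ?_
      exact (hasSum_zetaLogDerivDeriv (by linarith [hxm.1])).nonneg
        (zetaLogDerivDeriv_term_nonneg _)
    rw [hexp _ hRm fun z hz => lt_trans hx₁ hz.1, lintegral_zeroDensity_rectangle hx₁ hx hy]
    refine ⟨ENNReal.ofReal_ne_top, ?_⟩
    rw [ENNReal.toReal_ofReal (mul_nonneg (mul_nonneg (by positivity) hnn) (by linarith)),
      Complex.ofReal_mul, Complex.ofReal_mul, integral_zetaLogDerivDeriv hx₁ hx.le]
    push_cast
    ring
  · exact continuousOn_zeroDensity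
  · exact fun z hz => zeroDensity_nonneg hz
  · exact hexp
  · exact tendsto_zeroDensity
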